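/- Let $\mathsf X,\mathsf Y$ be Polish spaces with their Borel $\sigma$-algebras. Consider a hidden Markov model with initial law $\chi$ and transition kernel $M(x,dx')=m(x,x')\,\nu(dx')$ on $\mathsf X$ ($\nu$ $\sigma$-finite), and with observation density $g(x,\cdot)$ on $\mathsf Y$ with respect to a $\sigma$-finite measure. Fix $T\in\mathbb N$ and observations $y_0,\dots,y_T$, and put $g_t(x)=g(x,y_t)$. Let $\phi_{0:t|t}$ be the probability measure on $\mathsf X^{t+1}$ proportional to $\chi(dx_0)g_0(x_0)\prod_{u=1}^{t}M(x_{u-1},dx_u)g_u(x_u)$ (the joint smoothing distribution), and let $\phi_t$ be its last marginal (the filter). Auxiliary particle filter with $N\ge1$ particles. Let $\rho_0$ be a probability measure with $\chi\ll\rho_0$, let $\vartheta_t:\mathsf X\to(0,\infty)$ be measurable adjustment multipliers, and let $R_t(x,dx')=r_t(x,x')\,\nu(dx')$ be Markov proposal kernels with $M(x,\cdot)\ll R_t(x,\cdot)$ for all $x$, $t\ge1$. Define the weight functions $$\omega_0(x)=\frac{d\chi}{d\rho_0}(x)\,g_0(x),\qquad \omega_t(x,x')=\frac{m(x,x')g_t(x')}{\vartheta_t(x)r_t(x,x')}\quad(t\ge1),$$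 with $\omega_t(x,x')=0$ where $r_t(x,x')=0$. The initial particles $\xi_0^1,\dots,\xi_0^N$ are i.i.d. with law $\rho_0$, with weights $\omega_0^i=\omega_0(\xi_0^i)$. For $1\le t\le T$, conditionally on all particles and weights up to time $t-1$, the pairs $(I_t^i,\xi_t^i)_{i\le N}$ are i.i.d. with the law on $\{1,\dots,N\}\times\mathsf X$ proportional to $\omega_{t-1}^i\vartheta_t(\xi_{t-1}^i)R_t(\xi_{t-1}^i,dx)$, and $\omega_t^i=\omega_t(\xi_{t-1}^{I_t^i},\xi_t^i)$. Let $A_N$ be the event that $\sum_i\omega_s^i>0$ for all $0\le s\le T$, i.e. that the algorithm never loses all its weights; the conditional laws are only prescribed while this is the case. On $A_N$ the FFBSm estimator is $$\hat\phi_{0:T|T}(h)=\sum_{i_0,\dots,i_T=1}^N\Bigl(\prod_{u=1}^T\frac{\omega_{u-1}^{i_{u-1}}m(\xi_{u-1}^{i_{u-1}},\xi_u^{i_u})}{\sum_{\ell}\omega_{u-1}^{\ell}m(\xi_{u-1}^{\ell},\xi_u^{i_u})}\Bigr)\frac{\omega_T^{i_T}}{\sum_\ell\omega_T^\ell}\,h(\xi_0^{i_0},\dots,\xi_T^{i_T}).$$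 For $0\le t\le T$ and nonnegative measurable $h$ on $\mathsf X^{T+1}$ let $L_{t,T}(x_{0:t},h)=\int\cdots\int\prod_{u=t+1}^TM(x_{u-1},dx_u)g_u(x_u)\,h(x_{0:T})$ and $$F_{t,T}(x_t,h)=\int\cdots\int B_{\phi_{t-1}}(x_t,dx_{t-1})\cdots B_{\phi_0}(x_1,dx_0)\,L_{t,T}(x_{0:t},h),\qquad B_\eta(x,dx')=\frac{\eta(dx')\,m(x',x)}{\int\eta(dz)\,m(z,x)},$$ where $B_\eta(x,\cdot)=0$ if the denominator is $0$ or $\infty$. Write $\operatorname{osc}(h)=\sup_{x,x'}|h(x)-h(x')|$. **Theorem.** Assume that $g_t>0$ for $0\le t\le T$ and that $g_t$ $(0\le t\le T)$, $\vartheta_t$ $(1\le t\le T)$ and $\omega_t$ $(0\le t\le T)$ are bounded ($\omega_0$ up to a $\rho_0$-null set). Then there are constants $B,C\in(0,\infty)$, depending on $T$ and the model and algorithm data $(\chi,m,g,y_{0:T},\rho_0,\vartheta,r)$ only, such that for all $N\ge1$, all $\varepsilon>0$ and all bounded measurable $h:\mathsf X^{T+1}\to\mathbb R$, $$\mathbb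 P\bigl(A_N\cap\{|\hat\phi_{0:T|T}(h)-\phi_{0:T|T}(h)|\ge\varepsilon\}\bigr)\le B\exp\bigl(-CN\varepsilon^2/\operatorname{osc}(h)^2\bigr)$$ (the right-hand side being $0$ if $\operatorname{osc}(h)=0$), and $\mathbb P(A_N^c)\le Be^{-CN}$. In addition, for every $1\le t\le T$, $$N^{-1}\sum_{\ell=1}^N\omega_t^\ell F_{t,T}(\xi_t^\ell,\mathbf 1)\;\longrightarrow\;\frac{\phi_{t-1}[F_{t-1,T}(\cdot,\mathbf 1)]}{\phi_{t-1}(\vartheta_t)}\quad\text{in probability as }N\to\infty .$$ -/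

import Mathlib

open MeasureTheory ProbabilityTheory Filter
open scoped ENNReal NNReal

noncomputable section

/-- A fully dominated hidden Markov model on the state space `X` and the observation space `Y`,
together with a fixed record of observations (only `y 0, …, y T` matter for the horizon `T`). -/
structure HMM (X Y : Type*) [MeasurableSpace X] [MeasurableSpace Y] where
  /-- initial distribution of the state process -/
  χ : Measure X
  isProb_χ : IsProbabilityMeasure χ
  /-- reference measure on the state space -/
  ν : Measure X
  sigmaFinite_ν : SigmaFinite ν
  /-- transition density with respect to `ν` -/
  m : X → X → ℝ≥0
  measurable_m : Measurable (Function.uncurry m)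
  lintegral_m : ∀ x, ∫⁻ x', (m x x' : ℝ≥0∞) ∂ν = 1
  /-- reference measure on the observation space -/
  obsRef : Measure Y
  sigmaFinite_obsRef : SigmaFinite obsRef
  /-- conditional density, with respect to `obsRef`, of the observation given the state -/
  lik : X → Y → ℝ≥0
  measurable_lik : Measurable (Function.uncurry lik)
  lintegral_lik : ∀ x, ∫⁻ y, (lik x y : ℝ≥0∞) ∂obsRef = 1
  /-- the observed values -/
  y : ℕ → Y

attribute [instance] HMM.isProb_χ HMM.sigmaFinite_ν HMM.sigmaFinite_obsRef

namespace HMM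

variable {X Y : Type*} [MeasurableSpace X] [MeasurableSpace Y]

/-- The likelihood function `g_t` of the state at time `t`, given the observation `y_t`. -/
def g (H : HMM X Y) (t : ℕ) (x : X) : ℝ≥0 := H.lik x (H.y t)

/-- The transition kernel `M(x, dx') = m(x, x') ν(dx')`. -/
def M (H : HMM X Y) : Kernel X X :=
  Kernel.withDensity (Kernel.const X H.ν) (fun x x' => (H.m x x' : ℝ≥0∞))

instance (H : HMM X Y) : IsMarkovKernel H.M := by
  refine ⟨fun x => ⟨?_⟩⟩
  have hm : Measurable (Function.uncurry fun x x' => (H.m x x' : ℝ≥0∞)) :=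
    H.measurable_m.coe_nnreal_ennreal
  simp [M, Kernel.withDensity_apply' _ hm, H.lintegral_m x]

/-- The law of `X_{0:t}` (without the observations):
`χ(dx_0) M(x_0, dx_1) ⋯ M(x_{t-1}, dx_t)`. -/
def chainLaw (H : HMM X Y) : (t : ℕ) → Measure (Fin (t + 1) → X)
  | 0 => H.χ.map (fun x _ => x)
  | t + 1 =>
    ((chainLaw H t) ⊗ₘ (H.M.comap (fun x => x (Fin.last t)) (measurable_pi_apply _))).map
      (fun p => (Fin.snoc p.1 p.2 : Fin (t + 2) → X))

/-- The unnormalized joint smoothing distribution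
`χ(dx_0) g_0(x_0) ∏_{u=1}^t M(x_{u-1}, dx_u) g_u(x_u)`. -/
def unnormSmooth (H : HMM X Y) (t : ℕ) : Measure (Fin (t + 1) → X) :=
  (H.chainLaw t).withDensity (fun x => ∏ u : Fin (t + 1), (H.g u (x u) : ℝ≥0∞))

/-- The joint smoothing distribution `φ_{0:t|t}`: the posterior law of `X_{0:t}`
given `y_0, …, y_t`. -/
def smooth (H : HMM X Y) (t : ℕ) : Measure (Fin (t + 1) → X) :=
  (H.unnormSmooth t Set.univ)⁻¹ • H.unnormSmooth t

/-- The filtering distribution `φ_t = φ_{t|t}`: the last marginal of `φ_{0:t|t}`. -/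
def filt (H : HMM X Y) (t : ℕ) : Measure X :=
  (H.smooth t).map (fun x => x (Fin.last t))

/-- The backward kernel
`B_η(x, dx') = η(dx') m(x', x) / ∫ η(dz) m(z, x)`. -/
def backward (H : HMM X Y) (η : Measure X) (x : X) : Measure X :=
  (∫⁻ z, (H.m z x : ℝ≥0∞) ∂η)⁻¹ • η.withDensity (fun x' => (H.m x' x : ℝ≥0∞))

/-- `k` forward steps from time `t`:
`∫⋯∫ ∏_{u=t+1}^{t+k} M(x_{u-1}, dx_u) g_u(x_u) f(x)`; the integration variables replace the
coordinates `t+1, …, t+k` of the sequence `x`. -/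
def forwardInt (H : HMM X Y) (f : (ℕ → X) → ℝ≥0∞) : (k t : ℕ) → (ℕ → X) → ℝ≥0∞
  | 0, _, x => f x
  | k + 1, t, x =>
    ∫⁻ x', (H.g (t + 1) x' : ℝ≥0∞) *
      forwardInt H f k (t + 1) (Function.update x (t + 1) x') ∂(H.M (x t))

/-- The function `L_{t,T}(x_{0:t}, h)`, `t ≤ T`, for nonnegative `h` on `X^{T+1}`. The path
`x_{0:t}` is given by the first coordinates of a sequence, whose other coordinates
have no influence. -/
def L (H : HMM X Y) (t T : ℕ) (x : ℕ → X) (h : (Fin (T + 1) → X) → ℝ≥0∞) : ℝ≥0∞ :=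
  H.forwardInt (fun z => h (fun i => z i)) (T - t) t x

/-- `∫⋯∫ B_{φ_{t-1}}(x_t, dx_{t-1}) ⋯ B_{φ_0}(x_1, dx_0) f(x)`; the integration variables
replace the coordinates `t-1, …, 0` of the sequence `x`. -/
def backwardInt (H : HMM X Y) (f : (ℕ → X) → ℝ≥0∞) : (t : ℕ) → (ℕ → X) → ℝ≥0∞
  | 0, x => f x
  | t + 1, x =>
    ∫⁻ x', backwardInt H f t (Function.update x t x') ∂(H.backward (H.filt t) (x (t + 1)))

/-- `F_{t,T}(x_t, h) =
∫⋯∫ B_{φ_{t-1}}(x_t, dx_{t-1}) ⋯ B_{φ_0}(x_1, dx_0) L_{t,T}(x_{0:t}, h)`. -/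
def F (H : HMM X Y) (t T : ℕ) (xt : X) (h : (Fin (T + 1) → X) → ℝ≥0∞) : ℝ≥0∞ :=
  H.backwardInt (fun x => H.L t T x h) t (fun _ => xt)

end HMM

/-- The user's choices in the auxiliary particle filter for the model `H`: the instrumental
initial law, the adjustment multiplier functions and the proposal densities (used for `t ≥ 1`).
Positivity of the adjustment multipliers and the two domination conditions are what makes the
importance weights well defined as Radon-Nikodym derivatives. -/
structure Proposal {X Y : Type*} [MeasurableSpace X] [MeasurableSpace Y] (H : HMM X Y) where
  /-- law of the initial particles -/
  ρ₀ : Measure X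
  isProb_ρ₀ : IsProbabilityMeasure ρ₀
  /-- adjustment multiplier functions -/
  ϑ : ℕ → X → ℝ≥0
  measurable_ϑ : ∀ t, Measurable (ϑ t)
  ϑ_pos : ∀ t x, 0 < ϑ t x
  /-- proposal densities with respect to `ν` -/
  r : ℕ → X → X → ℝ≥0
  measurable_r : ∀ t, Measurable (Function.uncurry (r t))
  lintegral_r : ∀ t x, ∫⁻ x', (r t x x' : ℝ≥0∞) ∂H.ν = 1
  χ_ac : H.χ ≪ ρ₀
  M_ac : ∀ t x, H.M x ≪ H.ν.withDensity (fun x' => (r t x x' : ℝ≥0∞))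

attribute [instance] Proposal.isProb_ρ₀

namespace Proposal

variable {X Y : Type*} [MeasurableSpace X] [MeasurableSpace Y] {H : HMM X Y}

/-- The proposal kernel `R_t(x, dx') = r_t(x, x') ν(dx')`. -/
def R (Q : Proposal H) (t : ℕ) (x : X) : Measure X :=
  H.ν.withDensity (fun x' => (Q.r t x x' : ℝ≥0∞))

/-- The importance weight function at time `0`. -/
def w₀ (Q : Proposal H) (x : X) : ℝ≥0 := (H.χ.rnDeriv Q.ρ₀ x).toNNReal * H.g 0 x

/-- The importance weight functions at times `t ≥ 1`. -/
def w (Q : Proposal H) (t : ℕ) (x x' : X) : ℝ≥0 :=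
  H.m x x' * H.g t x' / (Q.ϑ t x * Q.r t x x')

/-- The importance weights attached to particles `ξ s i` with ancestor indices `I s i`
(`s ≥ 1`). -/
def wt (Q : Proposal H) {N : ℕ} (ξ : ℕ → Fin N → X) (I : ℕ → Fin N → Fin N) :
    ℕ → Fin N → ℝ≥0
  | 0, i => Q.w₀ (ξ 0 i)
  | s + 1, i => Q.w (s + 1) (ξ s (I (s + 1) i)) (ξ (s + 1) i)

/-- The instrumental distribution on pairs (index, particle) at time `t`, proportional to
`ω_i ϑ_t(x_i) R_t(x_i, dx)`, built on the weighted sample `(x_i, ω_i)` of time `t - 1`. -/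
def instr (Q : Proposal H) {N : ℕ} (t : ℕ) (x : Fin N → X) (ω : Fin N → ℝ≥0) :
    Measure (Fin N × X) :=
  (∑ i, (ω i * Q.ϑ t (x i) : ℝ≥0∞))⁻¹ •
    ∑ i, (ω i * Q.ϑ t (x i) : ℝ≥0∞) • (Q.R t (x i)).map (fun x' => (i, x'))

end Proposal

/-- A run, up to the horizon `T`, of the auxiliary particle filter with `N` particles on the
probability space `(Ω, P)`. The initial particles are i.i.d. with law `ρ₀`. Conditionally on the
particles and weights up to time `t`, the pairs `(I_{t+1}^i, ξ_{t+1}^i)` are i.i.d. with the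
instrumental distribution. This is required on the event that the weights have not all
vanished at some time `s ≤ t`; off this event the instrumental distribution is undefined and
the run is left unconstrained. -/
structure ParticleSystem {X Y : Type*} [MeasurableSpace X] [MeasurableSpace Y] {H : HMM X Y}
    (Q : Proposal H) (T N : ℕ) {Ω : Type*} [MeasurableSpace Ω] (P : Measure Ω) where
  /-- particles -/
  ξ : ℕ → Fin N → Ω → X
  /-- ancestor indices (not used at time `0`) -/
  I : ℕ → Fin N → Ω → Fin N
  measurable_ξ : ∀ s i, Measurable (ξ s i)
  measurable_I : ∀ s i, Measurable (I s i)
  indep_init : iIndepFun (fun i => ξ 0 i) P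
  law_init : ∀ i, P.map (ξ 0 i) = Q.ρ₀
  law_step : ∀ t < T, ∀ E : Set Ω,
    MeasurableSet[⨆ s ≤ t, ⨆ i, MeasurableSpace.comap
      (fun ω => (ξ s i ω, Q.wt (fun s i => ξ s i ω) (fun s i => I s i ω) s i))
        inferInstance] E →
    (∀ ω ∈ E, ∀ s ≤ t, 0 < ∑ i, Q.wt (fun s i => ξ s i ω) (fun s i => I s i ω) s i) →
    ∀ A : Fin N → Set (Fin N × X), (∀ i, MeasurableSet (A i)) →
      P (E ∩ {ω | ∀ i, (I (t + 1) i ω, ξ (t + 1) i ω) ∈ A i}) =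
        ∫⁻ ω in E, ∏ i, Q.instr (t + 1) (fun i => ξ t i ω)
          (Q.wt (fun s i => ξ s i ω) (fun s i => I s i ω) t) (A i) ∂P

namespace ParticleSystem

variable {X Y : Type*} [MeasurableSpace X] [MeasurableSpace Y] {H : HMM X Y} {Q : Proposal H}
  {T N : ℕ} {Ω : Type*} [MeasurableSpace Ω] {P : Measure Ω}

/-- The importance weight `ω_s^i`. -/
def weight (S : ParticleSystem Q T N P) (s : ℕ) (i : Fin N) (ω : Ω) : ℝ≥0 :=
  Q.wt (fun s i => S.ξ s i ω) (fun s i => S.I s i ω) s i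

/-- The event that the total weight is positive at each time `s ≤ T`, that is, that the
algorithm and its estimators are defined. -/
def alive (S : ParticleSystem Q T N P) : Set Ω :=
  {ω | ∀ s ≤ T, 0 < ∑ i, S.weight s i ω}

/-- The FFBSm estimator of `φ_{0:T|T}(h)`. -/
def ffbs (S : ParticleSystem Q T N P) (h : (Fin (T + 1) → X) → ℝ) (ω : Ω) : ℝ :=
  ∑ i : Fin (T + 1) → Fin N,
    (∏ u : Fin T,
      (S.weight u (i u.castSucc) ω : ℝ) *
          H.m (S.ξ u (i u.castSucc) ω) (S.ξ (u + 1) (i u.succ) ω) /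
        ∑ l, (S.weight u l ω : ℝ) * H.m (S.ξ u l ω) (S.ξ (u + 1) (i u.succ) ω)) *
    ((S.weight T (i (Fin.last T)) ω : ℝ) / ∑ l, (S.weight T l ω : ℝ)) *
    h (fun s => S.ξ s (i s) ω)

end ParticleSystem

/-- The oscillation `sup_{x,x'} |h(x) - h(x')|` (for bounded `h`). -/
def osc {Z : Type*} (h : Z → ℝ) : ℝ := ⨆ p : Z × Z, |h p.1 - h p.2|

end

/-!
Let `D_t` be the weighted particle cloud at time `t`. Integrating a new particle out of the
conditional law given the past and exchanging the sum over its ancestor with the backward weights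
(time reversal of the pair ancestor-particle) shows that the conditional mean of its contribution
to the unnormalized FFBSm estimator of time `t + 1` is a ratio of two FFBSm estimators of time `t`:
that of the forward step `L_{t,t+1}(·, h)` over that of the adjustment multiplier. Conditionally on
the past these contributions are i.i.d. and bounded, so Hoeffding's inequality controls their
average. Hence, by induction on `t`, the unnormalized estimators concentrate exponentially, and so
do the normalized ones, since the limit of the total weight over `N` is positive.

The conditional laws are prescribed only while the weights have not vanished, so all the tail
bounds are stated for `P` restricted to `aliveBefore t`. The event that the total weight vanishes
is itself a large deviation of the unnormalized estimator of the constant `1`, which bounds the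
probability of its complement.

The law of large numbers is the concentration of the unnormalized estimator of
`h(x_{0:t+1}) = F_{t+1,T}(x_{t+1}, 1)`, together with
`φ_t[F_{t,T}(·, 1)] = Z_T / Z_t`, `Z_t` being the normalizing constant of `φ_{0:t|t}`.
-/

/-! ### Subgaussian tails -/

/-- The random variable `Z` has subgaussian tails under the finite measure `μ`, with prefactor `B`
and rate `c`. Events on which an estimator is undefined are handled by restricting `μ`. -/
def HasSubgaussianTail {Ω : Type*} [MeasurableSpace Ω] (μ : Measure Ω) (Z : Ω → ℝ) (B c : ℝ) :
    Prop :=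
  ∀ ε > 0, μ.real {ω | ε ≤ |Z ω|} ≤ B * Real.exp (-(c * ε ^ 2))

namespace HasSubgaussianTail

variable {Ω : Type*} [MeasurableSpace Ω] {μ μ' : Measure Ω} {Z Z₁ Z₂ W : Ω → ℝ}
  {B B' B₁ B₂ c c' c₁ c₂ : ℝ}

lemma mono (h : HasSubgaussianTail μ Z B c) (hB : B ≤ B') (hc : c' ≤ c) :
    HasSubgaussianTail μ Z B' c' := by
  intro ε hε
  have hB₀ : 0 ≤ B := nonneg_of_mul_nonneg_left (measureReal_nonneg.trans (h ε hε))
    (Real.exp_pos _)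
  refine (h ε hε).trans ?_
  gcongr
  exact hB₀.trans hB

lemma mono_measure [IsFiniteMeasure μ] (h : HasSubgaussianTail μ Z B c) (hμ : μ' ≤ μ) :
    HasSubgaussianTail μ' Z B c := fun ε hε =>
  (ENNReal.toReal_mono (measure_ne_top _ _) (hμ _)).trans (h ε hε)

lemma of_abs_le_mul [IsFiniteMeasure μ] (h : HasSubgaussianTail μ Z B c) {r : ℝ} (hr : 0 < r)
    (hW : ∀ᵐ ω ∂μ, |W ω| ≤ r * |Z ω|) : HasSubgaussianTail μ W B (c / r ^ 2) := by
  intro ε hε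
  calc μ.real {ω | ε ≤ |W ω|} ≤ μ.real {ω | ε / r ≤ |Z ω|} := by
        refine ENNReal.toReal_mono (measure_ne_top _ _) (measure_mono_ae ?_)
        filter_upwards [hW] with ω hω (hε' : ε ≤ |W ω|)
        exact (div_le_iff₀' hr).2 (hε'.trans hω)
    _ ≤ B * Real.exp (-(c * (ε / r) ^ 2)) := h _ (div_pos hε hr)
    _ = B * Real.exp (-(c / r ^ 2 * ε ^ 2)) := by ring_nf

lemma of_abs_le_add [IsFiniteMeasure μ] (h₁ : HasSubgaussianTail μ Z₁ B₁ c₁)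
    (h₂ : HasSubgaussianTail μ Z₂ B₂ c₂) (hW : ∀ᵐ ω ∂μ, |W ω| ≤ |Z₁ ω| + |Z₂ ω|) :
    HasSubgaussianTail μ W (B₁ + B₂) (min c₁ c₂ / 4) := by
  intro ε hε
  have h₁' := h₁.mono le_rfl (min_le_left c₁ c₂) (ε / 2) (half_pos hε)
  have h₂' := h₂.mono le_rfl (min_le_right c₁ c₂) (ε / 2) (half_pos hε)
  calc μ.real {ω | ε ≤ |W ω|}
      ≤ μ.real ({ω | ε / 2 ≤ |Z₁ ω|} ∪ {ω | ε / 2 ≤ |Z₂ ω|}) := by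
        refine ENNReal.toReal_mono (measure_ne_top _ _) (measure_mono_ae ?_)
        filter_upwards [hW] with ω hω (hε' : ε ≤ |W ω|)
        change ε / 2 ≤ |Z₁ ω| ∨ ε / 2 ≤ |Z₂ ω|
        by_contra! hlt
        linarith
    _ ≤ μ.real {ω | ε / 2 ≤ |Z₁ ω|} + μ.real {ω | ε / 2 ≤ |Z₂ ω|} := measureReal_union_le _ _
    _ ≤ B₁ * Real.exp (-(min c₁ c₂ * (ε / 2) ^ 2)) +
          B₂ * Real.exp (-(min c₁ c₂ * (ε / 2) ^ 2)) := add_le_add h₁' h₂'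
    _ = (B₁ + B₂) * Real.exp (-(min c₁ c₂ / 4 * ε ^ 2)) := by ring_nf

lemma measureReal_le_add [IsFiniteMeasure μ] {A : Set Ω} (hA : MeasurableSet A)
    (h : HasSubgaussianTail (μ.restrict A) Z B c) {ε : ℝ} (hε : 0 < ε) :
    μ.real {ω | ε ≤ |Z ω|} ≤ μ.real Aᶜ + B * Real.exp (-(c * ε ^ 2)) := by
  have hsub : {ω | ε ≤ |Z ω|} ⊆ Aᶜ ∪ ({ω | ε ≤ |Z ω|} ∩ A) := fun ω hω =>
    (em (ω ∈ A)).elim (fun hωA => .inr ⟨hω, hωA⟩) .inl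
  have htail := h ε hε
  rw [measureReal_restrict_apply' hA] at htail
  calc μ.real {ω | ε ≤ |Z ω|} ≤ μ.real (Aᶜ ∪ ({ω | ε ≤ |Z ω|} ∩ A)) := measureReal_mono hsub
    _ ≤ _ := (measureReal_union_le _ _).trans (by gcongr)

end HasSubgaussianTail

lemma hasSubgaussianTail_average_of_hasSubgaussianMGF {Ω ι : Type*} [MeasurableSpace Ω]
    {P : Measure Ω} [Fintype ι] [Nonempty ι] {Y : ι → Ω → ℝ} (hind : iIndepFun Y P) {c : ℝ≥0}
    (hc : 0 < c) (hs : ∀ i, HasSubgaussianMGF (Y i) c P) :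
    HasSubgaussianTail P (fun ω => (Fintype.card ι : ℝ)⁻¹ * ∑ i, Y i ω) 2
      (Fintype.card ι / (2 * c)) := by
  intro ε hε
  have : IsProbabilityMeasure P := hind.isProbabilityMeasure
  set n : ℝ := (Fintype.card ι : ℝ) with hn
  have hn₀ : 0 < n := Nat.cast_pos.2 Fintype.card_pos
  have : (0 : ℝ) < c := hc
  have hsum_tail (W : ι → Ω → ℝ) (hW : iIndepFun W P) (hs : ∀ i, HasSubgaussianMGF (W i) c P) :
      P.real {ω | n * ε ≤ ∑ i, W i ω} ≤ Real.exp (-(n / (2 * c) * ε ^ 2)) := by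
    refine (HasSubgaussianMGF.measure_sum_ge_le_of_iIndepFun hW (s := Finset.univ)
      (fun i _ => hs i) (ε := n * ε) (by positivity)).trans_eq ?_
    rw [Finset.sum_const, Finset.card_univ, nsmul_eq_mul, NNReal.coe_mul, NNReal.coe_natCast, ← hn]
    congr 1
    field_simp
  have hsub : {ω | ε ≤ |n⁻¹ * ∑ i, Y i ω|} ⊆
      {ω | n * ε ≤ ∑ i, Y i ω} ∪ {ω | n * ε ≤ ∑ i, -Y i ω} := by
    intro ω (hω : ε ≤ |n⁻¹ * ∑ i, Y i ω|)
    rw [abs_mul, abs_of_pos (inv_pos.2 hn₀), le_inv_mul_iff₀ hn₀, le_abs,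
      ← Finset.sum_neg_distrib] at hω
    exact hω
  calc P.real {ω | ε ≤ |n⁻¹ * ∑ i, Y i ω|}
      ≤ P.real {ω | n * ε ≤ ∑ i, Y i ω} + P.real {ω | n * ε ≤ ∑ i, -Y i ω} :=
        (measureReal_mono hsub).trans (measureReal_union_le _ _)
    _ ≤ Real.exp (-(n / (2 * c) * ε ^ 2)) + Real.exp (-(n / (2 * c) * ε ^ 2)) :=
        add_le_add (hsum_tail Y hind hs) (hsum_tail (fun i ω => -Y i ω)
          (hind.comp (fun _ x => -x) fun _ => measurable_neg) fun i => (hs i).neg)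
    _ = 2 * Real.exp (-(n / (2 * c) * ε ^ 2)) := (two_mul _).symm

lemma hasSubgaussianTail_average {Ω ι : Type*} [MeasurableSpace Ω] {P : Measure Ω}
    [Fintype ι] [Nonempty ι] {X : ι → Ω → ℝ} (hind : iIndepFun X P)
    (hm : ∀ i, AEMeasurable (X i) P) {K a : ℝ} (hK : 0 < K) (hb : ∀ i, ∀ᵐ ω ∂P, |X i ω| ≤ K)
    (ha : ∀ i, ∫ ω, X i ω ∂P = a) :
    HasSubgaussianTail P (fun ω => (Fintype.card ι : ℝ)⁻¹ * ∑ i, X i ω - a) 2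
      (Fintype.card ι / (2 * K ^ 2)) := by
  have : IsProbabilityMeasure P := hind.isProbabilityMeasure
  have hparam : (‖K - -K‖₊ / 2) ^ 2 = Real.toNNReal K ^ 2 := by
    rw [sub_neg_eq_add, ← two_mul, nnnorm_mul, Real.nnnorm_of_nonneg hK.le, Real.nnnorm_two,
      mul_div_cancel_left₀ _ two_ne_zero, Real.toNNReal_of_nonneg hK.le]
  have hcentered (i : ι) : HasSubgaussianMGF (fun ω => X i ω - a) (Real.toNNReal K ^ 2) P := by
    rw [← ha i, ← hparam]
    exact hasSubgaussianMGF_of_mem_Icc (hm i) ((hb i).mono fun ω h => abs_le.1 h)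
  have htail := hasSubgaussianTail_average_of_hasSubgaussianMGF
    (hind.comp (fun _ x => x - a) fun _ => by fun_prop) (by positivity) hcentered
  convert htail using 1
  · funext ω
    simp only [Function.comp_apply, Finset.sum_sub_distrib, Finset.sum_const, Finset.card_univ,
      nsmul_eq_mul]
    field
  · simp [hK.le]

lemma hasSubgaussianTail_average_pi {E ι : Type*} [MeasurableSpace E] {m : Measure E}
    [IsProbabilityMeasure m] [Fintype ι] [Nonempty ι] {f : E → ℝ} (hf : Measurable f) {K : ℝ}
    (hK : 0 < K) (hfK : ∀ z, |f z| ≤ K) :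
    HasSubgaussianTail (Measure.pi fun _ : ι => m)
      (fun z => (Fintype.card ι : ℝ)⁻¹ * ∑ i, f (z i) - ∫ z, f z ∂m) 2
      (Fintype.card ι / (2 * K ^ 2)) :=
  hasSubgaussianTail_average (iIndepFun_pi fun _ => hf.aemeasurable)
    (fun i => (hf.comp (measurable_pi_apply i)).aemeasurable) hK
    (fun i => .of_forall fun z => hfK (z i))
    fun _ => integral_comp_eval hf.aestronglyMeasurable

section ConditionallyIID

variable {Ω D E ι : Type*} [MeasurableSpace Ω] [MeasurableSpace D] [MeasurableSpace E]
  [Fintype ι]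

/-- The kernel sending `d` to the law of an i.i.d. family, indexed by `ι`, with common
law `κ d`. -/
noncomputable def iidKernel (ι : Type*) [Fintype ι] (κ : Kernel D E) [IsFiniteKernel κ] :
    Kernel D (ι → E) where
  toFun d := Measure.pi fun _ => κ d
  measurable' := by
    refine Measurable.measure_of_isPiSystem generateFrom_pi.symm isPiSystem_pi ?_ ?_
    · rintro _ ⟨A, hA, rfl⟩
      simp only [Measure.pi_pi]
      exact Finset.measurable_prod _ fun i _ => κ.measurable_coe (hA i (Set.mem_univ i))
    · simp only [Measure.pi_univ]
      exact Finset.measurable_prod _ fun i _ => κ.measurable_coe MeasurableSet.univ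

variable {κ : Kernel D E} [IsFiniteKernel κ] {μ : Measure Ω} {V : Ω → D} {ζ : ι → Ω → E}

lemma iidKernel_apply (κ : Kernel D E) [IsFiniteKernel κ] (d : D) :
    iidKernel ι κ d = Measure.pi fun _ => κ d := rfl

instance (κ : Kernel D E) [IsFiniteKernel κ] : IsFiniteKernel (iidKernel ι κ) :=
  ⟨κ.bound ^ Fintype.card ι, ENNReal.pow_lt_top κ.bound_lt_top, fun d => by
    rw [iidKernel_apply, Measure.pi_univ]
    exact Finset.prod_le_pow_card _ _ _ fun _ _ => κ.measure_le_bound d Set.univ⟩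

lemma map_prodMk_eq_compProd_iidKernel [IsFiniteMeasure μ] (hV : Measurable V)
    (hζ : ∀ i, Measurable (ζ i))
    (h : ∀ U, MeasurableSet U → ∀ A : ι → Set E, (∀ i, MeasurableSet (A i)) →
      μ (V ⁻¹' U ∩ {ω | ∀ i, ζ i ω ∈ A i}) = ∫⁻ ω in V ⁻¹' U, ∏ i, κ (V ω) (A i) ∂μ) :
    μ.map (fun ω => (V ω, fun i => ζ i ω)) = μ.map V ⊗ₘ iidKernel ι κ := by
  have hVζ : Measurable fun ω => (V ω, fun i => ζ i ω) := hV.prodMk (measurable_pi_lambda _ hζ)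
  have hrect (U : Set D) (hU : MeasurableSet U) (A : ι → Set E) (hA : ∀ i, MeasurableSet (A i)) :
      μ.map (fun ω => (V ω, fun i => ζ i ω)) (U ×ˢ Set.univ.pi A) =
        (μ.map V ⊗ₘ iidKernel ι κ) (U ×ˢ Set.univ.pi A) := by
    have hA' : MeasurableSet (Set.univ.pi A) := .univ_pi hA
    rw [Measure.map_apply hVζ (hU.prod hA'), Measure.compProd_apply_prod hU hA',
      setLIntegral_map hU (Kernel.measurable_coe _ hA') hV]
    simp only [iidKernel_apply, Measure.pi_pi, ← h U hU A hA]
    congr 1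
    ext ω
    simp
  refine ext_of_generate_finite _ (generateFrom_eq_prod MeasurableSpace.generateFrom_measurableSet
    generateFrom_pi isCountablySpanning_measurableSet
    (.pi fun _ => isCountablySpanning_measurableSet)).symm
    (MeasurableSpace.isPiSystem_measurableSet.prod isPiSystem_pi) ?_ ?_
  · rintro _ ⟨U, hU, _, ⟨A, hA, rfl⟩, rfl⟩
    exact hrect U hU A fun i => hA i (Set.mem_univ i)
  · simpa using hrect Set.univ .univ (fun _ => Set.univ) fun _ => .univ

lemma ae_forall_mem_of_map_eq_compProd_iidKernel (hV : Measurable V)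
    (hζ : ∀ i, Measurable (ζ i))
    (hlaw : μ.map (fun ω => (V ω, fun i => ζ i ω)) = μ.map V ⊗ₘ iidKernel ι κ)
    {S : Set (D × E)} (hS : MeasurableSet S) (h : ∀ d, ∀ᵐ z ∂κ d, (d, z) ∈ S) :
    ∀ᵐ ω ∂μ, ∀ i, (V ω, ζ i ω) ∈ S := by
  have hVζ : Measurable fun ω => (V ω, fun i => ζ i ω) := hV.prodMk (measurable_pi_lambda _ hζ)
  refine ae_all_iff.2 fun i => ae_of_ae_map (p := fun q => (q.1, q.2 i) ∈ S) hVζ.aemeasurable ?_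
  rw [hlaw]
  refine Measure.ae_compProd_of_ae_ae
    (hS.preimage (measurable_fst.prodMk ((measurable_pi_apply i).comp measurable_snd))) ?_
  exact .of_forall fun d => (Measure.quasiMeasurePreserving_eval (fun _ : ι => κ d) i).ae (h d)

lemma hasSubgaussianTail_average_of_map_eq_compProd_iidKernel [IsFiniteMeasure μ] [Nonempty ι]
    (hV : Measurable V) (hζ : ∀ i, Measurable (ζ i))
    (hlaw : μ.map (fun ω => (V ω, fun i => ζ i ω)) = μ.map V ⊗ₘ iidKernel ι κ)
    (hκ : ∀ᵐ ω ∂μ, IsProbabilityMeasure (κ (V ω))) {f : D → E → ℝ}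
    (hf : Measurable (Function.uncurry f)) {K : ℝ} (hK : 0 < K) (hfK : ∀ d z, |f d z| ≤ K) :
    HasSubgaussianTail μ
      (fun ω => (Fintype.card ι : ℝ)⁻¹ * ∑ i, f (V ω) (ζ i ω) - ∫ z, f (V ω) z ∂κ (V ω))
      (2 * μ.real Set.univ) (Fintype.card ι / (2 * K ^ 2)) := by
  intro ε hε
  have hVζ : Measurable fun ω => (V ω, fun i => ζ i ω) := hV.prodMk (measurable_pi_lambda _ hζ)
  set b : ℝ := 2 * Real.exp (-(Fintype.card ι / (2 * K ^ 2) * ε ^ 2))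
  set dev : D × (ι → E) → ℝ := fun q =>
    (Fintype.card ι : ℝ)⁻¹ * ∑ i, f q.1 (q.2 i) - ∫ z, f q.1 z ∂κ q.1
  have hdev : MeasurableSet {q | ε ≤ |dev q|} := by
    have hint : Measurable fun d => ∫ z, f d z ∂κ d :=
      (hf.stronglyMeasurable.integral_kernel_prod_right' (κ := κ)).measurable
    refine measurableSet_le measurable_const (Measurable.abs (.sub ?_ (hint.comp measurable_fst)))
    exact .const_mul (Finset.measurable_sum _ fun i _ =>
      hf.comp (measurable_fst.prodMk ((measurable_pi_apply i).comp measurable_snd))) _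
  have hsection (d : D) (hd : IsProbabilityMeasure (κ d)) :
      iidKernel ι κ d (Prod.mk d ⁻¹' {q | ε ≤ |dev q|}) ≤ ENNReal.ofReal b := by
    have := hasSubgaussianTail_average_pi (ι := ι) (m := κ d) (hf.comp measurable_prodMk_left)
      hK (hfK d) ε hε
    exact (ENNReal.le_ofReal_iff_toReal_le (measure_ne_top _ _) (by positivity)).2 this
  refine ENNReal.toReal_le_of_le_ofReal (by positivity) ?_
  calc μ {ω | ε ≤ |dev (V ω, fun i => ζ i ω)|}
      = ∫⁻ ω, iidKernel ι κ (V ω) (Prod.mk (V ω) ⁻¹' {q | ε ≤ |dev q|}) ∂μ := by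
        rw [← lintegral_map (Kernel.measurable_kernel_prodMk_left hdev) hV,
          ← Measure.compProd_apply hdev, ← hlaw, Measure.map_apply hVζ hdev]
        rfl
    _ ≤ ∫⁻ _, ENNReal.ofReal b ∂μ := lintegral_mono_ae (hκ.mono fun ω => hsection (V ω))
    _ = ENNReal.ofReal (2 * μ.real Set.univ * Real.exp _) := by
        rw [lintegral_const, ← ofReal_measureReal, ← ENNReal.ofReal_mul (by positivity)]
        congr 1
        ring

end ConditionallyIID

section PositiveFunctional

variable {α : Type*} {L : (α → ℝ) →ₗ[ℝ] ℝ}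

lemma abs_linearMap_apply_le (hL : ∀ k, 0 ≤ k → 0 ≤ L k) {h k : α → ℝ} (hk : ∀ a, |h a| ≤ k a) :
    |L h| ≤ L k := by
  have hupper := hL (k - h) fun a => sub_nonneg.2 (le_of_abs_le (hk a))
  have hlower := hL (k + h) fun a => neg_le_iff_add_nonneg'.1 (neg_le_of_abs_le (hk a))
  rw [map_sub] at hupper
  rw [map_add] at hlower
  exact abs_le.2 ⟨by linarith, by linarith⟩

lemma abs_linearMap_apply_le_of_one_le_one (hL : ∀ k, 0 ≤ k → 0 ≤ L k) (hL₁ : L 1 ≤ 1)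
    {h : α → ℝ} {c : ℝ} (hc : 0 ≤ c) (hh : ∀ a, |h a| ≤ c) : |L h| ≤ c :=
  calc |L h| ≤ L (c • 1) := abs_linearMap_apply_le hL fun a => by simpa using hh a
    _ = c * L 1 := by rw [map_smul, smul_eq_mul]
    _ ≤ c := mul_le_of_le_one_right hc hL₁

end PositiveFunctional

lemma measurable_finSnoc {X : Type*} [MeasurableSpace X] {n : ℕ} :
    Measurable fun p : (Fin n → X) × X => (Fin.snoc p.1 p.2 : Fin (n + 1) → X) := by
  refine measurable_pi_lambda _ fun j => ?_
  refine Fin.lastCases ?_ (fun j => ?_) j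
  · simpa using measurable_snd
  · simp only [Fin.snoc_castSucc]
    fun_prop

/-! ### Backward smoothing of weighted particle clouds -/

namespace HMM

variable {X Y ι : Type*} [MeasurableSpace X] [MeasurableSpace Y] [Fintype ι] {H : HMM X Y}
  {d : ℕ → ι → X × ℝ≥0} {t : ℕ} {x : X}

/-- The unnormalized predictive density `∑ ω_t^l m(ξ_t^l, x)` at time `t + 1` of a cloud
`d s i = (ξ_s^i, ω_s^i)` of weighted particles. -/
noncomputable def predDensity (H : HMM X Y) (d : ℕ → ι → X × ℝ≥0) (t : ℕ) (x : X) : ℝ :=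
  ∑ l, ((d t l).2 : ℝ) * H.m (d t l).1 x

/-- The functional `h ↦ 𝔼[h(Z_0, …, Z_{t-1}, x)]`, where `(Z_s)` is the backward chain through
the weighted particle cloud `d` which is started at time `t` in the point `x` and moves to the
particle `l` of time `s` with probability proportional to `ω_s^l m(ξ_s^l, Z_{s+1})`. It is
nonnegative with mass at most one; mass is lost where all transition weights vanish. -/
noncomputable def backwardMean (H : HMM X Y) (d : ℕ → ι → X × ℝ≥0) :
    (t : ℕ) → X → ((Fin (t + 1) → X) → ℝ) →ₗ[ℝ] ℝ
  | 0, x => LinearMap.proj fun _ => x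
  | t + 1, x => (H.predDensity d t x)⁻¹ •
      ∑ l, ((d t l).2 * H.m (d t l).1 x : ℝ) • (backwardMean H d t (d t l).1).comp
        (LinearMap.funLeft ℝ ℝ fun z => (Fin.snoc z x : Fin (t + 2) → X))

/-- The unnormalized smoothing functional `h ↦ ∑ ω_t^l 𝔼[h(Z_0, …, Z_t) | Z_t = ξ_t^l]` of a
weighted particle cloud. -/
noncomputable def unnormEst (H : HMM X Y) (d : ℕ → ι → X × ℝ≥0) (t : ℕ) :
    ((Fin (t + 1) → X) → ℝ) →ₗ[ℝ] ℝ :=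
  ∑ l, ((d t l).2 : ℝ) • H.backwardMean d t (d t l).1

/-- The self-normalized smoothing functional of a weighted particle cloud. -/
noncomputable def est (H : HMM X Y) (d : ℕ → ι → X × ℝ≥0) (t : ℕ) :
    ((Fin (t + 1) → X) → ℝ) →ₗ[ℝ] ℝ :=
  (∑ l, ((d t l).2 : ℝ))⁻¹ • H.unnormEst d t

/-- Up to time `t`, the model can move to each particle of positive weight from a particle of
positive weight of the preceding generation. -/
def Reachable (H : HMM X Y) (d : ℕ → ι → X × ℝ≥0) (t : ℕ) : Prop :=
  ∀ s < t, ∀ i, 0 < (d (s + 1) i).2 → 0 < H.predDensity d s (d (s + 1) i).1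

lemma predDensity_nonneg : 0 ≤ H.predDensity d t x :=
  Finset.sum_nonneg fun _ _ => by positivity

lemma backwardMean_succ_apply (k : (Fin (t + 2) → X) → ℝ) :
    H.backwardMean d (t + 1) x k = (H.predDensity d t x)⁻¹ *
      ∑ l, (d t l).2 * H.m (d t l).1 x *
        H.backwardMean d t (d t l).1 fun z => k (Fin.snoc z x) := by
  simp only [backwardMean, LinearMap.smul_apply, LinearMap.sum_apply, LinearMap.comp_apply,
    smul_eq_mul]
  rfl

lemma unnormEst_apply (k : (Fin (t + 1) → X) → ℝ) :
    H.unnormEst d t k = ∑ l, (d t l).2 * H.backwardMean d t (d t l).1 k := by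
  simp [unnormEst]

lemma est_apply (k : (Fin (t + 1) → X) → ℝ) :
    H.est d t k = (∑ l, ((d t l).2 : ℝ))⁻¹ * H.unnormEst d t k := rfl

lemma backwardMean_nonneg {k : (Fin (t + 1) → X) → ℝ} (hk : 0 ≤ k) :
    0 ≤ H.backwardMean d t x k := by
  induction t generalizing x with
  | zero => exact hk _
  | succ t ih =>
    rw [backwardMean_succ_apply]
    exact mul_nonneg (inv_nonneg.2 predDensity_nonneg)
      (Finset.sum_nonneg fun l _ => mul_nonneg (by positivity) (ih fun z => hk _))

lemma backwardMean_one_le_one : H.backwardMean d t x 1 ≤ 1 := by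
  induction t generalizing x with
  | zero => exact le_rfl
  | succ t ih =>
    rw [backwardMean_succ_apply]
    refine inv_mul_le_one_of_le₀ (Finset.sum_le_sum fun l _ => ?_) predDensity_nonneg
    exact mul_le_of_le_one_right (by positivity) ih

lemma abs_backwardMean_le {k : (Fin (t + 1) → X) → ℝ} {c : ℝ} (hc : 0 ≤ c)
    (hk : ∀ z, |k z| ≤ c) : |H.backwardMean d t x k| ≤ c :=
  abs_linearMap_apply_le_of_one_le_one (fun _ => backwardMean_nonneg) backwardMean_one_le_one hc hk

lemma backwardMean_congr {d' : ℕ → ι → X × ℝ≥0} (h : ∀ s < t, d s = d' s) :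
    H.backwardMean d t x = H.backwardMean d' t x := by
  induction t generalizing x with
  | zero => rfl
  | succ t ih =>
    simp only [backwardMean, predDensity, h t t.lt_succ_self,
      ih fun s hs => h s (hs.trans t.lt_succ_self)]

/-- Both sides vanish where the predictive density does. -/
lemma predDensity_mul_backwardMean (k : (Fin (t + 2) → X) → ℝ) :
    H.predDensity d t x * H.backwardMean d (t + 1) x k =
      ∑ l, (d t l).2 * H.m (d t l).1 x *
        H.backwardMean d t (d t l).1 fun z => k (Fin.snoc z x) := by
  rw [backwardMean_succ_apply]
  rcases eq_or_ne (H.predDensity d t x) 0 with h₀ | h₀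
  · have hterm := (Finset.sum_eq_zero_iff_of_nonneg fun l _ => by positivity).1 h₀
    rw [h₀, zero_mul, Finset.sum_eq_zero fun l hl => by rw [hterm l hl, zero_mul]]
  · rw [mul_inv_cancel_left₀ h₀]

lemma backwardMean_last_mul (v : X → ℝ) (k : (Fin (t + 1) → X) → ℝ) :
    H.backwardMean d t x (fun z => v (z (Fin.last t)) * k z) = v x * H.backwardMean d t x k := by
  cases t with
  | zero => rfl
  | succ t =>
    have hcond (l : ι) : H.backwardMean d t (d t l).1 (fun z => v x * k (Fin.snoc z x)) =
        v x * H.backwardMean d t (d t l).1 (fun z => k (Fin.snoc z x)) :=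
      (H.backwardMean d t (d t l).1).map_smul (v x) _
    simp only [backwardMean_succ_apply, Fin.snoc_last, hcond, mul_left_comm _ (v x),
      ← Finset.mul_sum]

lemma backwardMean_one (hd : H.Reachable d t) {i : ι} (hi : 0 < (d t i).2) :
    H.backwardMean d t (d t i).1 1 = 1 := by
  induction t generalizing i with
  | zero => rfl
  | succ t ih =>
    have hterm (l : ι) : (d t l).2 * H.m (d t l).1 (d (t + 1) i).1 *
        H.backwardMean d t (d t l).1 1 = (d t l).2 * H.m (d t l).1 (d (t + 1) i).1 := by
      rcases eq_zero_or_pos (d t l).2 with hl | hl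
      · simp [hl]
      · rw [ih (fun s hs => hd s (hs.trans t.lt_succ_self)) hl, mul_one]
    rw [backwardMean_succ_apply]
    exact (congrArg _ (Finset.sum_congr rfl fun l _ => hterm l)).trans
      (inv_mul_cancel₀ (hd t t.lt_succ_self i hi).ne')

lemma unnormEst_last (hd : H.Reachable d t) (v : X → ℝ) :
    H.unnormEst d t (fun z => v (z (Fin.last t))) = ∑ l, (d t l).2 * v (d t l).1 := by
  rw [unnormEst_apply]
  refine Finset.sum_congr rfl fun l _ => ?_
  rcases eq_zero_or_pos (d t l).2 with hl | hl
  · simp [hl]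
  · have := backwardMean_last_mul (H := H) (d := d) (x := (d t l).1) v (1 : (Fin (t + 1) → X) → ℝ)
    simp only [Pi.one_apply, mul_one, backwardMean_one hd hl] at this
    rw [this]

lemma unnormEst_one (hd : H.Reachable d t) : H.unnormEst d t 1 = ∑ l, ((d t l).2 : ℝ) := by
  simpa only [mul_one] using! unnormEst_last hd fun _ => 1

lemma est_one (hd : H.Reachable d t) (hpos : 0 < ∑ l, (d t l).2) : H.est d t 1 = 1 := by
  rw [est_apply, unnormEst_one hd, inv_mul_cancel₀]
  exact_mod_cast hpos.ne'

lemma unnormEst_one_le : H.unnormEst d t 1 ≤ ∑ l, ((d t l).2 : ℝ) := by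
  rw [unnormEst_apply]
  exact Finset.sum_le_sum fun l _ =>
    mul_le_of_le_one_right (d t l).2.2 backwardMean_one_le_one

lemma abs_est_le {k : (Fin (t + 1) → X) → ℝ} {c : ℝ} (hc : 0 ≤ c) (hk : ∀ z, |k z| ≤ c) :
    |H.est d t k| ≤ c := by
  have hw : 0 ≤ ∑ l, ((d t l).2 : ℝ) := Finset.sum_nonneg fun _ _ => NNReal.coe_nonneg _
  refine abs_linearMap_apply_le_of_one_le_one (fun k hk => ?_)
    (inv_mul_le_one_of_le₀ unnormEst_one_le hw) hc hk
  rw [est_apply, unnormEst_apply]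
  exact mul_nonneg (inv_nonneg.2 hw)
    (Finset.sum_nonneg fun l _ => mul_nonneg (d t l).2.2 (backwardMean_nonneg hk))

lemma measurable_backwardMean {A : Type*} [MeasurableSpace A] {δ : A → ℕ → ι → X × ℝ≥0}
    (hδ : Measurable δ) {x : A → X} (hx : Measurable x) {k : A → (Fin (t + 1) → X) → ℝ}
    (hk : Measurable (Function.uncurry k)) :
    Measurable fun a => H.backwardMean (δ a) t (x a) (k a) := by
  have hδ' (s : ℕ) (i : ι) : Measurable fun a => δ a s i := by fun_prop
  induction t generalizing x with
  | zero => exact hk.comp (measurable_id.prodMk (measurable_pi_lambda _ fun _ => hx))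
  | succ t ih =>
    have hm (l : ι) : Measurable fun a => ((δ a t l).2 : ℝ) * H.m (δ a t l).1 (x a) :=
      (hδ' t l).snd.coe_nnreal_real.mul
        (H.measurable_m.comp ((hδ' t l).fst.prodMk hx)).coe_nnreal_real
    simp only [backwardMean_succ_apply]
    refine (Finset.measurable_sum _ fun l _ => hm l).inv.mul
      (Finset.measurable_sum _ fun l _ => (hm l).mul (ih (hδ' t l).fst ?_))
    exact hk.comp (measurable_fst.prodMk (measurable_finSnoc.comp
      (measurable_snd.prodMk (hx.comp measurable_fst))))

lemma sum_paths_eq_sum_mul_backwardMean (t : ℕ) (c : ι → ℝ) (h : (Fin (t + 1) → X) → ℝ) :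
    ∑ i : Fin (t + 1) → ι,
      (∏ u : Fin t, ((d u (i u.castSucc)).2 : ℝ) *
          H.m (d u (i u.castSucc)).1 (d (u + 1) (i u.succ)).1 /
        H.predDensity d u (d (u + 1) (i u.succ)).1) *
      c (i (Fin.last t)) * h (fun s => (d s (i s)).1) =
      ∑ j, c j * H.backwardMean d t (d t j).1 h := by
  induction t generalizing c with
  | zero =>
    rw [← (Equiv.funUnique (Fin 1) ι).symm.sum_comp]
    refine Finset.sum_congr rfl fun j _ => ?_
    have hpath : (fun s : Fin 1 => (d s ((Equiv.funUnique (Fin 1) ι).symm j s)).1) =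
        fun _ => (d 0 j).1 := funext fun s => by rw [Fin.fin_one_eq_zero s]; rfl
    rw [hpath, Finset.univ_eq_empty, Finset.prod_empty, one_mul]
    rfl
  | succ t ih =>
    rw [← (Fin.snocEquiv fun _ : Fin (t + 2) => ι).sum_comp, Fintype.sum_prod_type]
    refine Finset.sum_congr rfl fun j _ => ?_
    have hpath (i : Fin (t + 1) → ι) :
        (fun s : Fin (t + 2) => (d s ((Fin.snocEquiv fun _ => ι) (j, i) s)).1) =
          Fin.snoc (fun s : Fin (t + 1) => (d s (i s)).1) (d (t + 1) j).1 := by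
      funext s
      refine Fin.lastCases ?_ (fun s => ?_) s <;> simp
    have hrec := ih (fun l => c j * ((H.predDensity d t (d (t + 1) j).1)⁻¹ *
        ((d t l).2 * H.m (d t l).1 (d (t + 1) j).1)))
      fun z => h (Fin.snoc z (d (t + 1) j).1)
    simp only [mul_assoc (c j), mul_assoc (H.predDensity d t (d (t + 1) j).1)⁻¹,
      ← Finset.mul_sum, ← backwardMean_succ_apply] at hrec
    rw [← hrec]
    refine Finset.sum_congr rfl fun i _ => ?_
    rw [Fin.prod_univ_castSucc, hpath]
    simp only [Fin.snocEquiv_apply, Fin.snoc_castSucc, Fin.snoc_last, Fin.succ_last,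
      Fin.succ_castSucc, Fin.val_castSucc, Fin.val_last]
    ring

end HMM

namespace ParticleSystem

variable {X Y : Type*} [MeasurableSpace X] [MeasurableSpace Y] {H : HMM X Y} {Q : Proposal H}
  {T N : ℕ} {Ω : Type*} [MeasurableSpace Ω] {P : Measure Ω}

/-- The weighted particle cloud of a run, all generations included. -/
noncomputable def cloud (S : ParticleSystem Q T N P) (ω : Ω) (s : ℕ) (i : Fin N) : X × ℝ≥0 :=
  (S.ξ s i ω, S.weight s i ω)

lemma ffbs_eq_est (S : ParticleSystem Q T N P) (h : (Fin (T + 1) → X) → ℝ) (ω : Ω) :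
    S.ffbs h ω = H.est (S.cloud ω) T h := by
  refine (HMM.sum_paths_eq_sum_mul_backwardMean (H := H) (d := S.cloud ω) T
    (fun i => (S.weight T i ω : ℝ) / ∑ l, (S.weight T l ω : ℝ)) h).trans ?_
  rw [HMM.est_apply, HMM.unnormEst_apply, Finset.mul_sum]
  exact Finset.sum_congr rfl fun l _ => by simp only [cloud]; ring

end ParticleSystem

/-! ### Smoothing distributions -/

namespace HMM

variable {X Y : Type*} [MeasurableSpace X] [MeasurableSpace Y] {H : HMM X Y} {t : ℕ}

lemma measurable_g (H : HMM X Y) (t : ℕ) : Measurable (H.g t) :=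
  H.measurable_lik.comp (measurable_id.prodMk measurable_const)

lemma measurable_m_left (H : HMM X Y) (x : X) : Measurable (H.m x) :=
  H.measurable_m.comp measurable_prodMk_left

lemma measurable_m_right (H : HMM X Y) (x : X) : Measurable fun z => H.m z x :=
  H.measurable_m.comp measurable_prodMk_right

lemma measurable_m_mul_g (H : HMM X Y) (t : ℕ) (x : X) :
    Measurable fun x' => H.m x x' * H.g t x' :=
  (H.measurable_m_left x).mul (H.measurable_g t)

/-- The unnormalized filtering kernel `M(x, dx') g_t(x')`. -/
noncomputable def MG (H : HMM X Y) (t : ℕ) : Kernel X X :=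
  Kernel.withDensity (Kernel.const X H.ν) fun x x' => (H.m x x' * H.g t x' : ℝ≥0)

instance : IsSFiniteKernel (H.MG t) :=
  Kernel.IsSFiniteKernel.withDensity _ fun _ _ => ENNReal.coe_ne_top

lemma MG_apply (H : HMM X Y) (t : ℕ) (x : X) :
    H.MG t x = H.ν.withDensity fun x' => (H.m x x' * H.g t x' : ℝ≥0) :=
  Kernel.withDensity_apply _
    (H.measurable_m.mul ((H.measurable_g t).comp measurable_snd)).coe_nnreal_ennreal x

lemma lintegral_MG (t : ℕ) (x : X) {f : X → ℝ≥0∞} (hf : Measurable f) :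
    ∫⁻ x', f x' ∂H.MG t x = ∫⁻ x', H.m x x' * (H.g t x' * f x') ∂H.ν := by
  rw [MG_apply, lintegral_withDensity_eq_lintegral_mul _
    (H.measurable_m_mul_g t x).coe_nnreal_ennreal hf]
  simp [mul_assoc]

lemma lintegral_MG_eq_lintegral_M (t : ℕ) (x : X) {f : X → ℝ≥0∞} (hf : Measurable f) :
    ∫⁻ x', f x' ∂H.MG t x = ∫⁻ x', H.g t x' * f x' ∂H.M x := by
  have hm : Measurable (Function.uncurry fun x x' => (H.m x x' : ℝ≥0∞)) :=
    H.measurable_m.coe_nnreal_ennreal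
  have hgf : Measurable fun x' => H.g t x' * f x' := (H.measurable_g t).coe_nnreal_ennreal.mul hf
  rw [lintegral_MG t x hf, M, Kernel.lintegral_withDensity _ hm _ hgf, Kernel.const_apply]

lemma integral_MG (t : ℕ) (x : X) (f : X → ℝ) :
    ∫ x', f x' ∂H.MG t x = ∫ x', H.m x x' * H.g t x' * f x' ∂H.ν := by
  rw [MG_apply, integral_withDensity_eq_integral_smul (H.measurable_m_mul_g t x)]
  simp [NNReal.smul_def]

lemma integrable_MG_iff {t : ℕ} {x : X} {f : X → ℝ} :
    Integrable f (H.MG t x) ↔ Integrable (fun x' => H.m x x' * H.g t x' * f x') H.ν := by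
  rw [MG_apply, integrable_withDensity_iff_integrable_smul (H.measurable_m_mul_g t x)]
  simp [NNReal.smul_def]

/-- The kernel `M(x_t, dx_{t+1}) g_{t+1}(x_{t+1})` as a kernel on paths `x_{0:t}`. -/
noncomputable def stepKernel (H : HMM X Y) (t : ℕ) : Kernel (Fin (t + 1) → X) X :=
  (H.MG (t + 1)).comap (fun z => z (Fin.last t)) (measurable_pi_apply _)

instance : IsSFiniteKernel (H.stepKernel t) :=
  inferInstanceAs (IsSFiniteKernel (Kernel.comap _ _ _))

instance : IsProbabilityMeasure (H.chainLaw t) := by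
  induction t with
  | zero => exact Measure.isProbabilityMeasure_map (by fun_prop)
  | succ t ih => exact Measure.isProbabilityMeasure_map measurable_finSnoc.aemeasurable

instance : SFinite (H.unnormSmooth t) := inferInstanceAs (SFinite (Measure.withDensity _ _))

instance : SFinite (H.smooth t) := inferInstanceAs (SFinite (_ • H.unnormSmooth t))

instance : SFinite (H.filt t) := inferInstanceAs (SFinite ((H.smooth t).map _))

lemma integral_filt {f : X → ℝ} (hf : Measurable f) (t : ℕ) :
    ∫ x, f x ∂H.filt t = ∫ z, f (z (Fin.last t)) ∂H.smooth t :=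
  integral_map (measurable_pi_apply _).aemeasurable hf.aestronglyMeasurable

lemma measurable_prod_g (H : HMM X Y) (t : ℕ) :
    Measurable fun x : Fin (t + 1) → X => ∏ u : Fin (t + 1), (H.g u (x u) : ℝ≥0∞) :=
  Finset.measurable_prod _ fun u _ =>
    ((H.measurable_g u).comp (measurable_pi_apply u)).coe_nnreal_ennreal

lemma unnormSmooth_zero (H : HMM X Y) :
    H.unnormSmooth 0 =
      (H.χ.withDensity fun x => H.g 0 x).map fun x (_ : Fin (0 + 1)) => x := by
  have hconst : Measurable fun (x : X) (_ : Fin (0 + 1)) => x := by fun_prop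
  refine Measure.ext_of_lintegral _ fun f hf => ?_
  have hfc : Measurable fun x => f fun _ => x := hf.comp hconst
  rw [unnormSmooth, lintegral_withDensity_eq_lintegral_mul _ (H.measurable_prod_g 0) hf, chainLaw,
    lintegral_map ((H.measurable_prod_g 0).mul hf) hconst, lintegral_map hf hconst,
    lintegral_withDensity_eq_lintegral_mul _ (H.measurable_g 0).coe_nnreal_ennreal hfc]
  simp

lemma unnormSmooth_succ (H : HMM X Y) (t : ℕ) :
    H.unnormSmooth (t + 1) = ((H.unnormSmooth t) ⊗ₘ H.stepKernel t).map
      (fun p => (Fin.snoc p.1 p.2 : Fin (t + 2) → X)) := by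
  refine Measure.ext_of_lintegral _ fun f hf => ?_
  have hfs : Measurable fun p : (Fin (t + 1) → X) × X => f (Fin.snoc p.1 p.2) :=
    hf.comp measurable_finSnoc
  have hPf := (H.measurable_prod_g (t + 1)).mul hf
  have hPfs : Measurable fun p : (Fin (t + 1) → X) × X =>
      ((fun x : Fin (t + 2) → X => ∏ u : Fin (t + 2), (H.g u (x u) : ℝ≥0∞)) * f)
        (Fin.snoc p.1 p.2) := hPf.comp measurable_finSnoc
  rw [unnormSmooth, lintegral_withDensity_eq_lintegral_mul _ (H.measurable_prod_g _) hf, chainLaw,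
    lintegral_map hPf measurable_finSnoc, Measure.lintegral_compProd hPfs,
    lintegral_map hf measurable_finSnoc, Measure.lintegral_compProd hfs, unnormSmooth,
    lintegral_withDensity_eq_lintegral_mul _ (H.measurable_prod_g t)
      hfs.lintegral_kernel_prod_right']
  refine lintegral_congr fun z => ?_
  have hfz : Measurable fun x => f (Fin.snoc z x) := hfs.comp measurable_prodMk_left
  simp only [Pi.mul_apply, stepKernel, Kernel.comap_apply]
  rw [lintegral_MG_eq_lintegral_M _ _ hfz, ← lintegral_const_mul' _ _
    (ENNReal.prod_ne_top fun u _ => ENNReal.coe_ne_top)]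
  refine lintegral_congr fun x => ?_
  rw [Fin.prod_univ_castSucc]
  simp [mul_assoc]

lemma lintegral_unnormSmooth_succ {f : (Fin (t + 2) → X) → ℝ≥0∞} (hf : Measurable f) :
    ∫⁻ z, f z ∂H.unnormSmooth (t + 1) =
      ∫⁻ z, ∫⁻ x, f (Fin.snoc z x) ∂H.MG (t + 1) (z (Fin.last t)) ∂H.unnormSmooth t := by
  have hfs : Measurable fun p : (Fin (t + 1) → X) × X => f (Fin.snoc p.1 p.2) :=
    hf.comp measurable_finSnoc
  rw [unnormSmooth_succ, lintegral_map hf measurable_finSnoc, Measure.lintegral_compProd hfs]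
  rfl

/-- The likelihood of the observations `y_0, …, y_t`, the normalizing constant of the joint
smoothing distribution. -/
noncomputable def evidence (H : HMM X Y) (t : ℕ) : ℝ≥0∞ := H.unnormSmooth t Set.univ

lemma evidence_zero (H : HMM X Y) : H.evidence 0 = ∫⁻ x, H.g 0 x ∂H.χ := by
  rw [evidence, unnormSmooth_zero, Measure.map_apply (by fun_prop) .univ, Set.preimage_univ,
    withDensity_apply _ .univ, Measure.restrict_univ]

lemma evidence_succ (H : HMM X Y) (t : ℕ) :
    H.evidence (t + 1) = ∫⁻ z, H.MG (t + 1) (z (Fin.last t)) Set.univ ∂H.unnormSmooth t := by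
  simpa [evidence] using lintegral_unnormSmooth_succ (H := H) (t := t) (f := 1) measurable_const

lemma evidence_ne_zero (hg : ∀ s ≤ t, ∀ x, 0 < H.g s x) : H.evidence t ≠ 0 := by
  have hprod : (fun x : Fin (t + 1) → X => ∏ u : Fin (t + 1), (H.g u (x u) : ℝ≥0∞)).support =
      Set.univ := by
    refine Set.eq_univ_of_forall fun x => Finset.prod_ne_zero_iff.2 fun u _ => ?_
    simpa using (hg u (Nat.lt_succ_iff.1 u.2) (x u)).ne'
  rw [evidence, unnormSmooth, withDensity_apply _ .univ, Measure.restrict_univ, ← pos_iff_ne_zero,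
    lintegral_pos_iff_support (H.measurable_prod_g t), hprod, measure_univ]
  exact one_pos

lemma smul_smooth_succ (h₀ : H.evidence (t + 1) ≠ 0) (h : H.evidence (t + 1) ≠ ∞) :
    (H.evidence (t + 1) / H.evidence t) • H.smooth (t + 1) =
      ((H.smooth t) ⊗ₘ H.stepKernel t).map
        fun p => (Fin.snoc p.1 p.2 : Fin (t + 2) → X) := by
  rw [smooth, smooth, Measure.compProd_smul_left, Measure.map_smul, ← unnormSmooth_succ, smul_smul,
    ENNReal.div_eq_inv_mul, mul_assoc]
  exact congrArg (· • _) (by rw [← evidence, ENNReal.mul_inv_cancel h₀ h, mul_one, evidence])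

lemma smul_filt_succ (h₀ : H.evidence (t + 1) ≠ 0) (h : H.evidence (t + 1) ≠ ∞) :
    (H.evidence (t + 1) / H.evidence t) • H.filt (t + 1) = H.MG (t + 1) ∘ₘ H.filt t := by
  refine Measure.ext_of_lintegral _ fun f hf => ?_
  have hlast : Measurable fun z : Fin (t + 2) → X => f (z (Fin.last (t + 1))) :=
    hf.comp (measurable_pi_apply _)
  have hsnoc : Measurable fun p : (Fin (t + 1) → X) × X =>
      f ((Fin.snoc p.1 p.2 : Fin (t + 2) → X) (Fin.last (t + 1))) := hlast.comp measurable_finSnoc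
  rw [filt, ← Measure.map_smul, smul_smooth_succ h₀ h, lintegral_map hf (measurable_pi_apply _),
    lintegral_map hlast measurable_finSnoc,
    Measure.lintegral_compProd hsnoc,
    Measure.lintegral_bind (H.MG (t + 1)).measurable.aemeasurable hf.aemeasurable, filt,
    lintegral_map hf.lintegral_kernel (measurable_pi_apply _)]
  simp only [Fin.snoc_last]
  rfl

/-- The function `x_{0:t} ↦ ∫ M(x_t, dx) g_{t+1}(x) k(x_{0:t}, x)`. -/
noncomputable def fwd (H : HMM X Y) (t : ℕ) (k : (Fin (t + 2) → X) → ℝ) (z : Fin (t + 1) → X) :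
    ℝ :=
  ∫ x, k (Fin.snoc z x) ∂(H.MG (t + 1) (z (Fin.last t)))

lemma measurable_fwd {k : (Fin (t + 2) → X) → ℝ} (hk : Measurable k) :
    Measurable (H.fwd t k) :=
  ((hk.comp measurable_finSnoc).stronglyMeasurable.integral_kernel_prod_right'
    (κ := H.stepKernel t)).measurable

lemma integral_fwd (h₀ : H.evidence (t + 1) ≠ 0) (h : H.evidence (t + 1) ≠ ∞)
    (ht : H.evidence t ≠ 0) {k : (Fin (t + 2) → X) → ℝ} (hk : Integrable k (H.smooth (t + 1))) :
    ∫ z, H.fwd t k z ∂H.smooth t =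
      (H.evidence (t + 1) / H.evidence t).toReal * ∫ z, k z ∂H.smooth (t + 1) := by
  have hint := hk.smul_measure (ENNReal.div_ne_top h ht)
  rw [smul_smooth_succ h₀ h] at hint
  have hsnoc : Integrable (fun p => k (Fin.snoc p.1 p.2)) (H.smooth t ⊗ₘ H.stepKernel t) :=
    hint.comp_measurable measurable_finSnoc
  rw [← smul_eq_mul, ← integral_smul_measure, smul_smooth_succ h₀ h,
    integral_map measurable_finSnoc.aemeasurable hint.aestronglyMeasurable,
    Measure.integral_compProd hsnoc]
  rfl

/-- The conditions under which the smoothing distributions up to the horizon `T` are well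
defined, with a common bound on the total mass of the kernels `M(x, dx') g_t(x')`. -/
structure Regular (H : HMM X Y) (T : ℕ) (K : ℝ≥0) : Prop where
  evidence_ne_zero_last : H.evidence T ≠ 0
  evidence_zero_ne_top : H.evidence 0 ≠ ∞
  MG_univ_le : ∀ t < T, ∀ x, H.MG (t + 1) x Set.univ ≤ K

namespace Regular

variable {T : ℕ} {K : ℝ≥0}

lemma evidence_succ_le (h : H.Regular T K) (ht : t < T) :
    H.evidence (t + 1) ≤ K * H.evidence t := by
  rw [evidence_succ, evidence, ← lintegral_const]
  exact lintegral_mono fun z => h.MG_univ_le t ht _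

lemma evidence_ne_top (h : H.Regular T K) (ht : t ≤ T) : H.evidence t ≠ ∞ := by
  induction t with
  | zero => exact h.evidence_zero_ne_top
  | succ t ih =>
    exact ne_top_of_le_ne_top (ENNReal.mul_ne_top ENNReal.coe_ne_top (ih (by omega)))
      (h.evidence_succ_le ht)

lemma evidence_ne_zero (h : H.Regular T K) (ht : t ≤ T) : H.evidence t ≠ 0 := by
  induction ht using Nat.decreasingInduction with
  | self => exact h.evidence_ne_zero_last
  | of_succ s hs ih =>
    intro h₀
    exact ih (le_bot_iff.1 ((h.evidence_succ_le hs).trans_eq (by rw [h₀, mul_zero, bot_eq_zero])))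

lemma isProbabilityMeasure_smooth (h : H.Regular T K) (ht : t ≤ T) :
    IsProbabilityMeasure (H.smooth t) :=
  ⟨ENNReal.inv_mul_cancel (h.evidence_ne_zero ht) (h.evidence_ne_top ht)⟩

lemma isProbabilityMeasure_filt (h : H.Regular T K) (ht : t ≤ T) :
    IsProbabilityMeasure (H.filt t) :=
  have := h.isProbabilityMeasure_smooth ht
  Measure.isProbabilityMeasure_map (measurable_pi_apply _).aemeasurable

lemma isFiniteMeasure_MG (h : H.Regular T K) (ht : t < T) (x : X) :
    IsFiniteMeasure (H.MG (t + 1) x) :=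
  ⟨(h.MG_univ_le t ht x).trans_lt ENNReal.coe_lt_top⟩

lemma abs_fwd_le (h : H.Regular T K) (ht : t < T) {k : (Fin (t + 2) → X) → ℝ} {c : ℝ}
    (hc : 0 ≤ c) (hk : ∀ z, |k z| ≤ c) (z : Fin (t + 1) → X) : |H.fwd t k z| ≤ c * K := by
  have := h.isFiniteMeasure_MG ht (z (Fin.last t))
  calc |H.fwd t k z| ≤ c * (H.MG (t + 1) (z (Fin.last t))).real Set.univ :=
        norm_integral_le_of_norm_le_const (f := fun x => k (Fin.snoc z x))
          (ae_of_all _ fun x => hk _)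
    _ ≤ c * K := by
        gcongr
        exact ENNReal.toReal_le_coe_of_le_coe (h.MG_univ_le t ht _)

lemma evidence_ratio_pos (h : H.Regular T K) (ht : t < T) :
    0 < (H.evidence (t + 1) / H.evidence t).toReal :=
  ENNReal.toReal_pos
    (ENNReal.div_ne_zero.2 ⟨h.evidence_ne_zero ht, h.evidence_ne_top ht.le⟩)
    (ENNReal.div_ne_top (h.evidence_ne_top ht) (h.evidence_ne_zero ht.le))

end Regular

section TimeReversal

variable {ι : Type*} [Fintype ι] {d : ℕ → ι → X × ℝ≥0}

lemma integrable_backwardMean {A : Type*} [MeasurableSpace A] {μ : Measure A} {x : X}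
    {k : (Fin (t + 1) → X) → A → ℝ} (hk : ∀ z, Integrable (k z) μ) :
    Integrable (fun a => H.backwardMean d t x fun z => k z a) μ := by
  induction t generalizing x with
  | zero => exact hk _
  | succ t ih =>
    simp only [backwardMean_succ_apply]
    exact (integrable_finsetSum _ fun l _ => (ih fun z => hk _).const_mul _).const_mul _

lemma backwardMean_integral {A : Type*} [MeasurableSpace A] {μ : Measure A} {x : X}
    {k : (Fin (t + 1) → X) → A → ℝ} (hk : ∀ z, Integrable (k z) μ) :
    H.backwardMean d t x (fun z => ∫ a, k z a ∂μ) =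
      ∫ a, H.backwardMean d t x (fun z => k z a) ∂μ := by
  induction t generalizing x with
  | zero => rfl
  | succ t ih =>
    simp only [backwardMean_succ_apply]
    rw [integral_const_mul, integral_finsetSum _ fun l _ =>
      (integrable_backwardMean fun z => hk _).const_mul _]
    simp only [integral_const_mul, ih fun _ => hk _]

/-- Time reversal: `ω_t^l m(ξ_t^l, x)` is at the same time the weight of a forward move from
`ξ_t^l` to `x` and, up to normalization, the probability of the backward move. -/
lemma sum_mul_integral_backwardMean [∀ x, IsFiniteMeasure (H.MG (t + 1) x)]
    {k : (Fin (t + 2) → X) → ℝ} (hk : Measurable k) {c : ℝ} (hkc : ∀ z, |k z| ≤ c) :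
    ∑ l, (d t l).2 * ∫ x, H.backwardMean d (t + 1) x k ∂H.MG (t + 1) (d t l).1 =
      H.unnormEst d t (H.fwd t k) := by
  have hc (z : Fin (t + 2) → X) : 0 ≤ c := (abs_nonneg _).trans (hkc z)
  have hforward (z : Fin (t + 1) → X) : Integrable
      (fun x => H.m (z (Fin.last t)) x * (H.g (t + 1) x * k (Fin.snoc z x))) H.ν := by
    simp only [← mul_assoc]
    exact integrable_MG_iff.1 (.of_bound ((hk.comp measurable_finSnoc).comp
      measurable_prodMk_left).aestronglyMeasurable c (ae_of_all _ fun x => hkc _))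
  have hbackward (l : ι) : Integrable (fun x => (d t l).2 *
      (H.m (d t l).1 x * H.g (t + 1) x * H.backwardMean d (t + 1) x k)) H.ν :=
    (integrable_MG_iff.1 (.of_bound (measurable_backwardMean (δ := fun _ => d) measurable_const
      measurable_id (k := fun _ => k) (hk.comp measurable_snd)).aestronglyMeasurable c
      (ae_of_all _ fun x => abs_backwardMean_le (hc fun _ => x) hkc))).const_mul _
  have hfwd : H.fwd t k = fun z =>
      ∫ x, H.m (z (Fin.last t)) x * (H.g (t + 1) x * k (Fin.snoc z x)) ∂H.ν := by
    funext z
    simp only [fwd, integral_MG, mul_assoc]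
  simp only [integral_MG, ← integral_const_mul, unnormEst_apply, hfwd,
    backwardMean_integral hforward]
  rw [← integral_finsetSum _ fun l _ => hbackward l, ← integral_finsetSum _ fun l _ =>
    (integrable_backwardMean hforward).const_mul _]
  congr 1 with x
  calc ∑ l, (d t l).2 * (H.m (d t l).1 x * H.g (t + 1) x * H.backwardMean d (t + 1) x k)
      = H.predDensity d t x * H.backwardMean d (t + 1) x fun z => H.g (t + 1) x * k z := by
        rw [show (fun z => (H.g (t + 1) x : ℝ) * k z) = (H.g (t + 1) x : ℝ) • k from rfl, map_smul,
          predDensity, Finset.sum_mul]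
        exact Finset.sum_congr rfl fun l _ => by rw [smul_eq_mul]; ring
    _ = ∑ l, (d t l).2 * H.backwardMean d t (d t l).1 fun z =>
          H.m (z (Fin.last t)) x * (H.g (t + 1) x * k (Fin.snoc z x)) := by
        rw [predDensity_mul_backwardMean]
        exact Finset.sum_congr rfl fun l _ => by
          rw [backwardMean_last_mul fun y => (H.m y x : ℝ), mul_assoc]

end TimeReversal

/-! ### Backward and forward integrals -/

lemma measurable_lintegral_m (η : Measure X) [SFinite η] :
    Measurable fun x => ∫⁻ z, (H.m z x : ℝ≥0∞) ∂η :=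
  Measurable.lintegral_prod_right' (f := fun p : X × X => (H.m p.2 p.1 : ℝ≥0∞))
    (H.measurable_m.comp measurable_swap).coe_nnreal_ennreal

lemma bind_MG (t : ℕ) (η : Measure X) [SFinite η] :
    H.MG t ∘ₘ η = H.ν.withDensity fun x => (∫⁻ z, H.m z x ∂η) * H.g t x := by
  refine Measure.ext_of_lintegral _ fun f hf => ?_
  have hgf : Measurable fun x => H.g t x * f x := (H.measurable_g t).coe_nnreal_ennreal.mul hf
  have hD : Measurable fun x => (∫⁻ z, H.m z x ∂η) * (H.g t x : ℝ≥0∞) :=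
    (measurable_lintegral_m η).mul (H.measurable_g t).coe_nnreal_ennreal
  have hm : Measurable (Function.uncurry fun z x => H.m z x * (H.g t x * f x)) :=
    H.measurable_m.coe_nnreal_ennreal.mul (hgf.comp measurable_snd)
  rw [Measure.lintegral_bind (H.MG t).measurable.aemeasurable hf.aemeasurable,
    lintegral_withDensity_eq_lintegral_mul _ hD hf]
  simp only [lintegral_MG _ _ hf]
  rw [lintegral_lintegral_swap hm.aemeasurable]
  refine lintegral_congr fun x => ?_
  rw [lintegral_mul_const _ (H.measurable_m_right x).coe_nnreal_ennreal, Pi.mul_apply, mul_assoc]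

lemma ae_bind_MG_lintegral_m (t : ℕ) (η : Measure X) [IsFiniteMeasure η] :
    ∀ᵐ x ∂(H.MG t ∘ₘ η), ∫⁻ z, (H.m z x : ℝ≥0∞) ∂η ≠ 0 ∧ ∫⁻ z, (H.m z x : ℝ≥0∞) ∂η ≠ ∞ := by
  have hmass : ∫⁻ x, ∫⁻ z, (H.m z x : ℝ≥0∞) ∂η ∂H.ν ≠ ∞ := by
    rw [lintegral_lintegral_swap (f := fun x z => (H.m z x : ℝ≥0∞))
      (H.measurable_m.comp measurable_swap).coe_nnreal_ennreal.aemeasurable]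
    simp [H.lintegral_m]
  have hD : Measurable fun x => (∫⁻ z, H.m z x ∂η) * (H.g t x : ℝ≥0∞) :=
    (measurable_lintegral_m η).mul (H.measurable_g t).coe_nnreal_ennreal
  rw [bind_MG, ae_withDensity_iff hD]
  filter_upwards [ae_lt_top (measurable_lintegral_m η) hmass] with x hx hpos
  exact ⟨left_ne_zero_of_mul hpos, hx.ne⟩

lemma lintegral_backward (η : Measure X) (x : X) {f : X → ℝ≥0∞} (hf : Measurable f) :
    ∫⁻ z, f z ∂H.backward η x =
      (∫⁻ z, (H.m z x : ℝ≥0∞) ∂η)⁻¹ * ∫⁻ z, (H.m z x : ℝ≥0∞) * f z ∂η := by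
  rw [backward, lintegral_smul_measure, smul_eq_mul,
    lintegral_withDensity_eq_lintegral_mul _ (H.measurable_m_right x).coe_nnreal_ennreal hf]
  rfl

lemma backward_univ (η : Measure X) (x : X) :
    H.backward η x Set.univ =
      (∫⁻ z, (H.m z x : ℝ≥0∞) ∂η)⁻¹ * ∫⁻ z, (H.m z x : ℝ≥0∞) ∂η := by
  simpa using lintegral_backward (H := H) η x (f := 1) measurable_const

lemma backward_absolutelyContinuous (η : Measure X) (x : X) : H.backward η x ≪ η :=
  Measure.smul_absolutelyContinuous.trans (withDensity_absolutelyContinuous _ _)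

lemma measurable_backwardInt {f : (ℕ → X) → ℝ≥0∞} (hf : Measurable f) (t : ℕ) :
    Measurable (H.backwardInt f t) := by
  induction t with
  | zero => exact hf
  | succ t ih =>
    have hupd : Measurable fun p : (ℕ → X) × X => H.backwardInt f t (Function.update p.1 t p.2) :=
      ih.comp measurable_update'
    have hm : Measurable fun p : (ℕ → X) × X => H.m p.2 (p.1 (t + 1)) :=
      H.measurable_m.comp (measurable_snd.prodMk
        ((measurable_pi_apply (t + 1)).comp measurable_fst))
    have hstep : H.backwardInt f (t + 1) = fun x =>
        (∫⁻ z, (H.m z (x (t + 1)) : ℝ≥0∞) ∂H.filt t)⁻¹ *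
          ∫⁻ z, (H.m z (x (t + 1)) : ℝ≥0∞) * H.backwardInt f t (Function.update x t z)
            ∂H.filt t := by
      funext x
      exact lintegral_backward _ _ (hupd.comp measurable_prodMk_left)
    rw [hstep]
    exact ((measurable_lintegral_m _).comp (measurable_pi_apply (t + 1))).inv.mul
      (hm.coe_nnreal_ennreal.mul hupd).lintegral_prod_right'

lemma backwardInt_le {f : (ℕ → X) → ℝ≥0∞} {c : ℝ≥0∞} (hf : ∀ z, f z ≤ c) (t : ℕ) (z : ℕ → X) :
    H.backwardInt f t z ≤ c := by
  induction t generalizing z with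
  | zero => exact hf z
  | succ t ih =>
    calc H.backwardInt f (t + 1) z ≤ ∫⁻ _, c ∂H.backward (H.filt t) (z (t + 1)) :=
          lintegral_mono fun x' => ih _
      _ ≤ c := by
          rw [lintegral_const, backward_univ]
          exact mul_le_of_le_one_right' (ENNReal.inv_mul_le_one _)

/-- The total mass `∫⋯∫ ∏_{u=t+1}^{t+k} M(x_{u-1}, dx_u) g_u(x_u)` of `k` unnormalized filtering
steps from `x_t`. -/
noncomputable def fwdMass (H : HMM X Y) : ℕ → ℕ → X → ℝ≥0∞
  | 0, _, _ => 1
  | k + 1, t, x => ∫⁻ x', fwdMass H k (t + 1) x' ∂H.MG (t + 1) x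

lemma measurable_fwdMass (k t : ℕ) : Measurable (H.fwdMass k t) := by
  induction k generalizing t with
  | zero => exact measurable_const
  | succ k ih => exact (ih (t + 1)).lintegral_kernel

lemma forwardInt_one (k t : ℕ) (x : ℕ → X) :
    H.forwardInt (fun _ => 1) k t x = H.fwdMass k t (x t) := by
  induction k generalizing t x with
  | zero => rfl
  | succ k ih =>
    rw [forwardInt, fwdMass, lintegral_MG_eq_lintegral_M _ _ (measurable_fwdMass _ _)]
    simp [ih]

lemma lintegral_fwdMass_unnormSmooth (k t : ℕ) :
    ∫⁻ z, H.fwdMass k t (z (Fin.last t)) ∂H.unnormSmooth t = H.evidence (t + k) := by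
  induction k generalizing t with
  | zero => simp [fwdMass, evidence]
  | succ k ih =>
    have hmeas : Measurable fun z : Fin (t + 2) → X => H.fwdMass k (t + 1) (z (Fin.last (t + 1))) :=
      (measurable_fwdMass k (t + 1)).comp (measurable_pi_apply _)
    rw [← Nat.add_assoc, Nat.add_right_comm, ← ih (t + 1), lintegral_unnormSmooth_succ hmeas]
    simp only [fwdMass, Fin.snoc_last]

lemma lintegral_fwdMass_filt (k t : ℕ) :
    ∫⁻ x, H.fwdMass k t x ∂H.filt t = H.evidence (t + k) / H.evidence t := by
  rw [filt, lintegral_map (measurable_fwdMass k t) (measurable_pi_apply _), smooth,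
    lintegral_smul_measure, lintegral_fwdMass_unnormSmooth, smul_eq_mul, ENNReal.div_eq_inv_mul]
  rfl

lemma F_one_eq (t T : ℕ) (x : X) : H.F t T x (fun _ => 1) =
    H.backwardInt (fun z => H.fwdMass (T - t) t (z t)) t (fun _ => x) := by
  simp only [F, L, forwardInt_one]

lemma measurable_F_one (t T : ℕ) : Measurable fun x => H.F t T x fun _ => 1 := by
  simp only [F_one_eq]
  exact (measurable_backwardInt ((measurable_fwdMass _ _).comp (measurable_pi_apply t)) t).comp
    (measurable_pi_lambda _ fun _ => measurable_id)

namespace Regular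

variable {T : ℕ} {K : ℝ≥0}

lemma ae_filt_succ_lintegral_m (h : H.Regular T K) (ht : t < T) :
    ∀ᵐ x ∂H.filt (t + 1), ∫⁻ z, (H.m z x : ℝ≥0∞) ∂H.filt t ≠ 0 ∧
      ∫⁻ z, (H.m z x : ℝ≥0∞) ∂H.filt t ≠ ∞ := by
  have := h.isProbabilityMeasure_filt ht.le
  have hae := ae_bind_MG_lintegral_m (H := H) (t + 1) (H.filt t)
  rw [← smul_filt_succ (h.evidence_ne_zero ht) (h.evidence_ne_top ht)] at hae
  exact (Measure.absolutelyContinuous_smul (ENNReal.div_ne_zero.2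
    ⟨h.evidence_ne_zero ht, h.evidence_ne_top ht.le⟩)).ae_le hae

/-- The backward kernels started at `φ_t`-almost every point are probability measures, so
integrating against them does not change a function of the coordinates `s ≥ t`. -/
lemma ae_backwardInt_eq (h : H.Regular T K) (ht : t ≤ T) :
    ∀ᵐ x ∂H.filt t, ∀ (f : (ℕ → X) → ℝ≥0∞) (z : ℕ → X), z t = x →
      (∀ z' : ℕ → X, (∀ s, t ≤ s → z' s = z s) → f z' = f z) → H.backwardInt f t z = f z := by
  induction t with
  | zero => exact ae_of_all _ fun x f z _ _ => rfl
  | succ t ih =>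
    filter_upwards [h.ae_filt_succ_lintegral_m ht] with x hx f z hz hf
    subst hz
    have hinner : ∀ᵐ x' ∂H.backward (H.filt t) (z (t + 1)),
        H.backwardInt f t (Function.update z t x') = f z := by
      filter_upwards [(backward_absolutelyContinuous _ _).ae_le (ih (by omega))] with x' hx'
      have hupd : f (Function.update z t x') = f z :=
        hf _ fun s hs => Function.update_of_ne (by omega) _ _
      rw [hx' f _ (Function.update_self _ _ _), hupd]
      intro z' hz'
      rw [hupd]
      exact hf _ fun s hs => by rw [hz' s (by omega), Function.update_of_ne (by omega)]
    rw [backwardInt, lintegral_congr_ae hinner, lintegral_const, backward_univ,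
      ENNReal.inv_mul_cancel hx.1 hx.2, mul_one]

lemma lintegral_F_one (h : H.Regular T K) (ht : t ≤ T) :
    ∫⁻ x, H.F t T x (fun _ => 1) ∂H.filt t = H.evidence T / H.evidence t := by
  have hae : ∀ᵐ x ∂H.filt t, H.F t T x (fun _ => 1) = H.fwdMass (T - t) t x := by
    filter_upwards [h.ae_backwardInt_eq ht] with x hx
    rw [F_one_eq, hx _ (fun _ => x) rfl fun z' hz' => by rw [hz' t le_rfl]]
  rw [lintegral_congr_ae hae, lintegral_fwdMass_filt, Nat.add_sub_cancel' ht]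

lemma fwdMass_le (h : H.Regular T K) {k t : ℕ} (hkt : t + k ≤ T) (x : X) :
    H.fwdMass k t x ≤ (K : ℝ≥0∞) ^ k := by
  induction k generalizing t x with
  | zero => simp [fwdMass]
  | succ k ih =>
    calc H.fwdMass (k + 1) t x ≤ ∫⁻ _, (K : ℝ≥0∞) ^ k ∂H.MG (t + 1) x :=
          lintegral_mono fun x' => ih (by omega) x'
      _ ≤ K ^ (k + 1) := by
          rw [lintegral_const, pow_succ]
          gcongr
          exact h.MG_univ_le t (by omega) x

lemma F_one_le (h : H.Regular T K) (ht : t ≤ T) (x : X) :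
    H.F t T x (fun _ => 1) ≤ (K ^ (T - t) : ℝ≥0) := by
  rw [F_one_eq, ENNReal.coe_pow]
  exact backwardInt_le (fun z => h.fwdMass_le (by omega) _) _ _

lemma abs_toReal_F_one_le (h : H.Regular T K) (ht : t ≤ T) (x : X) :
    |(H.F t T x (fun _ => 1)).toReal| ≤ (K ^ (T - t) : ℝ≥0) := by
  rw [abs_of_nonneg ENNReal.toReal_nonneg]
  exact ENNReal.toReal_le_coe_of_le_coe (h.F_one_le ht x)

lemma integral_toReal_F_one (h : H.Regular T K) (ht : t ≤ T) :
    ∫ x, (H.F t T x (fun _ => 1)).toReal ∂H.filt t =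
      (H.evidence T / H.evidence t).toReal := by
  rw [integral_toReal (measurable_F_one t T).aemeasurable
    (ae_of_all _ fun x => (h.F_one_le ht x).trans_lt ENNReal.coe_lt_top), h.lintegral_F_one ht]

end Regular

end HMM

/-! ### Importance weights and the instrumental distribution -/

namespace Proposal

variable {X Y : Type*} [MeasurableSpace X] [MeasurableSpace Y] {H : HMM X Y} {N t T : ℕ}
  {K : ℝ≥0}

lemma measurable_r_left (Q : Proposal H) (t : ℕ) (x : X) : Measurable (Q.r t x) :=
  (Q.measurable_r t).comp measurable_prodMk_left

instance (Q : Proposal H) (t : ℕ) (x : X) : IsProbabilityMeasure (Q.R t x) :=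
  ⟨by simp [R, Q.lintegral_r]⟩

lemma measurable_R (Q : Proposal H) (t : ℕ) : Measurable (Q.R t) := by
  have hr : Measurable (Function.uncurry fun x x' => (Q.r t x x' : ℝ≥0∞)) :=
    (Q.measurable_r t).coe_nnreal_ennreal
  have hR : Q.R t = Kernel.withDensity (Kernel.const X H.ν) fun x x' => (Q.r t x x' : ℝ≥0∞) := by
    funext x
    simp [R, Kernel.withDensity_apply _ hr]
  rw [hR]
  exact Kernel.measurable _

lemma measurable_w (Q : Proposal H) (t : ℕ) : Measurable (Function.uncurry (Q.w t)) :=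
  (H.measurable_m.mul ((H.measurable_g t).comp measurable_snd)).div
    (((Q.measurable_ϑ t).comp measurable_fst).mul (Q.measurable_r t))

lemma measurable_w₀ (Q : Proposal H) : Measurable Q.w₀ :=
  (Measure.measurable_rnDeriv _ _).ennreal_toNNReal.mul (H.measurable_g 0)

lemma ae_m_eq_zero_of_r_eq_zero (Q : Proposal H) (t : ℕ) (x : X) :
    ∀ᵐ x' ∂H.ν, Q.r t x x' = 0 → H.m x x' = 0 := by
  have hr : Measurable fun x' => (Q.r t x x' : ℝ≥0∞) :=
    (Q.measurable_r_left t x).coe_nnreal_ennreal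
  have hM : H.M x = H.ν.withDensity fun x' => (H.m x x' : ℝ≥0∞) :=
    Kernel.withDensity_apply _ H.measurable_m.coe_nnreal_ennreal x
  have hR : ∀ᵐ x' ∂H.M x, (Q.r t x x' : ℝ≥0∞) ≠ 0 :=
    (Q.M_ac t x).ae_le ((ae_withDensity_iff hr).2 (ae_of_all _ fun _ h => h))
  rw [hM, ae_withDensity_iff (H.measurable_m_left x).coe_nnreal_ennreal] at hR
  filter_upwards [hR] with x' hx' hr₀
  by_contra hm
  exact hx' (ENNReal.coe_ne_zero.2 hm) (ENNReal.coe_eq_zero.2 hr₀)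

lemma smul_R_withDensity_w (Q : Proposal H) (t : ℕ) (x : X) :
    Q.ϑ t x • (Q.R t x).withDensity (fun x' => Q.w t x x') = H.MG t x := by
  have hr : Measurable fun x' => (Q.r t x x' : ℝ≥0∞) :=
    (Q.measurable_r_left t x).coe_nnreal_ennreal
  have hw : Measurable fun x' => (Q.w t x x' : ℝ≥0∞) :=
    ((Q.measurable_w t).comp measurable_prodMk_left).coe_nnreal_ennreal
  rw [R, ← withDensity_mul _ hr hw, ENNReal.smul_def, ← withDensity_smul _ (hr.mul hw),
    HMM.MG_apply]
  refine withDensity_congr_ae ?_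
  filter_upwards [Q.ae_m_eq_zero_of_r_eq_zero t x] with x' hx'
  have hweight : Q.ϑ t x * (Q.r t x x' * Q.w t x x') = H.m x x' * H.g t x' := by
    rcases eq_or_ne (Q.r t x x') 0 with hr₀ | hr₀
    · simp [hr₀, hx' hr₀]
    · rw [w, ← mul_assoc, mul_div_cancel₀ _ (mul_ne_zero (Q.ϑ_pos t x).ne' hr₀)]
  simp only [Pi.smul_apply, Pi.mul_apply, smul_eq_mul]
  exact_mod_cast hweight

lemma integral_w_mul (Q : Proposal H) (t : ℕ) (x : X) (f : X → ℝ) :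
    (Q.ϑ t x : ℝ) * ∫ x', Q.w t x x' * f x' ∂Q.R t x = ∫ x', f x' ∂H.MG t x := by
  have hw : Measurable (Q.w t x) := (Q.measurable_w t).comp measurable_prodMk_left
  rw [← Q.smul_R_withDensity_w, integral_smul_nnreal_measure,
    integral_withDensity_eq_integral_smul hw]
  rfl

lemma ρ₀_withDensity_w₀ (Q : Proposal H) :
    Q.ρ₀.withDensity (fun x => Q.w₀ x) = H.χ.withDensity fun x => H.g 0 x := by
  have hg : Measurable fun x => (H.g 0 x : ℝ≥0∞) := (H.measurable_g 0).coe_nnreal_ennreal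
  conv_rhs => rw [← Measure.withDensity_rnDeriv_eq _ _ Q.χ_ac,
    ← withDensity_mul _ (Measure.measurable_rnDeriv _ _) hg]
  refine withDensity_congr_ae ?_
  filter_upwards [H.χ.rnDeriv_lt_top Q.ρ₀] with x hx
  simp [w₀, ENNReal.coe_toNNReal hx.ne]

lemma integral_w₀_mul (Q : Proposal H) (f : X → ℝ) :
    ∫ x, Q.w₀ x * f x ∂Q.ρ₀ = ∫ x, f x ∂H.χ.withDensity fun x => H.g 0 x := by
  rw [← Q.ρ₀_withDensity_w₀, integral_withDensity_eq_integral_smul Q.measurable_w₀]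
  rfl

lemma measurable_instr (Q : Proposal H) (t : ℕ) :
    Measurable fun p : (Fin N → X) × (Fin N → ℝ≥0) => Q.instr t p.1 p.2 := by
  have hc (i : Fin N) : Measurable fun p : (Fin N → X) × (Fin N → ℝ≥0) =>
      (p.2 i : ℝ≥0∞) * Q.ϑ t (p.1 i) :=
    ((measurable_pi_apply i).comp measurable_snd).coe_nnreal_ennreal.mul
      ((Q.measurable_ϑ t).comp ((measurable_pi_apply i).comp measurable_fst)).coe_nnreal_ennreal
  refine Measure.measurable_of_measurable_coe _ fun A hA => ?_
  simp only [instr, Measure.smul_apply, Measure.finsetSum_apply, smul_eq_mul,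
    Measure.map_apply measurable_prodMk_left hA]
  refine (Finset.measurable_sum _ fun i _ => hc i).inv.mul
    (Finset.measurable_sum _ fun i _ => (hc i).mul ?_)
  exact (Measure.measurable_coe (measurable_prodMk_left hA)).comp
    ((Q.measurable_R t).comp ((measurable_pi_apply i).comp measurable_fst))

lemma instr_univ (Q : Proposal H) (t : ℕ) (x : Fin N → X) (ω : Fin N → ℝ≥0) :
    Q.instr t x ω Set.univ =
      (∑ i, (ω i * Q.ϑ t (x i) : ℝ≥0∞))⁻¹ * ∑ i, (ω i * Q.ϑ t (x i) : ℝ≥0∞) := by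
  simp [instr, Measure.map_apply measurable_prodMk_left MeasurableSet.univ]

lemma sum_mul_ϑ_pos (Q : Proposal H) (t : ℕ) (x : Fin N → X) {ω : Fin N → ℝ≥0}
    (hω : 0 < ∑ i, ω i) : 0 < ∑ i, ω i * Q.ϑ t (x i) := by
  obtain ⟨i, -, hi⟩ := Finset.exists_ne_zero_of_sum_ne_zero hω.ne'
  exact Finset.sum_pos' (fun _ _ => zero_le)
    ⟨i, Finset.mem_univ i, mul_pos (pos_iff_ne_zero.2 hi) (Q.ϑ_pos t _)⟩

lemma isProbabilityMeasure_instr (Q : Proposal H) (t : ℕ) (x : Fin N → X) {ω : Fin N → ℝ≥0}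
    (hω : 0 < ∑ i, ω i) : IsProbabilityMeasure (Q.instr t x ω) := by
  refine ⟨?_⟩
  rw [instr_univ]
  have hpos := (Q.sum_mul_ϑ_pos t x hω).ne'
  norm_cast
  exact inv_mul_cancel₀ hpos

lemma ae_instr_weight_pos (Q : Proposal H) (t : ℕ) (x : Fin N → X) (ω : Fin N → ℝ≥0) :
    ∀ᵐ p ∂Q.instr t x ω, 0 < ω p.1 := by
  have hS : MeasurableSet {p : Fin N × X | 0 < ω p.1} :=
    measurableSet_lt measurable_const ((measurable_of_countable ω).comp measurable_fst)
  refine Measure.ae_smul_measure (ae_finsetSum_measure_iff.2 fun i _ => ?_) _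
  rcases eq_zero_or_pos (ω i) with hi | hi
  · simp [hi]
  · refine Measure.ae_smul_measure ?_ _
    rw [ae_map_iff measurable_prodMk_left.aemeasurable hS]
    exact ae_of_all _ fun _ => hi

lemma integral_instr (Q : Proposal H) (t : ℕ) (x : Fin N → X) (ω : Fin N → ℝ≥0)
    {f : Fin N × X → ℝ} (hf : Measurable f)
    (hfi : ∀ i, Integrable (fun x' => f (i, x')) (Q.R t (x i))) :
    ∫ p, f p ∂Q.instr t x ω = (∑ i, (ω i : ℝ) * Q.ϑ t (x i))⁻¹ *
      ∑ i, (ω i : ℝ) * Q.ϑ t (x i) * ∫ x', f (i, x') ∂Q.R t (x i) := by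
  have hsum : (∑ i, (ω i * Q.ϑ t (x i) : ℝ≥0∞)).toReal = ∑ i, (ω i : ℝ) * Q.ϑ t (x i) := by
    rw [ENNReal.toReal_sum fun i _ => ENNReal.mul_ne_top ENNReal.coe_ne_top ENNReal.coe_ne_top]
    simp
  rw [instr, integral_smul_measure, integral_finsetSum_measure]
  · simp only [integral_smul_measure, ENNReal.toReal_inv, hsum, ENNReal.toReal_mul,
      integral_map measurable_prodMk_left.aemeasurable hf.aestronglyMeasurable,
      ENNReal.coe_toReal, smul_eq_mul]
  · intro i _
    exact ((integrable_map_measure hf.aestronglyMeasurable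
      measurable_prodMk_left.aemeasurable).2 (hfi i)).smul_measure
        (ENNReal.mul_ne_top ENNReal.coe_ne_top ENNReal.coe_ne_top)

/-- The instrumental distribution of the pairs (ancestor index, particle) of time `t + 1`, as a
kernel whose source is the weighted cloud up to time `t`. It vanishes where all the weights of time
`t` do. -/
noncomputable def instrKernel (Q : Proposal H) (N t : ℕ) :
    Kernel (ℕ → Fin N → X × ℝ≥0) (Fin N × X) where
  toFun d := Q.instr (t + 1) (fun i => (d t i).1) fun i => (d t i).2
  measurable' := (Q.measurable_instr (t + 1)).comp
    (f := fun d : ℕ → Fin N → X × ℝ≥0 => (fun i => (d t i).1, fun i => (d t i).2)) (by fun_prop)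

lemma instrKernel_apply (Q : Proposal H) (t : ℕ) (d : ℕ → Fin N → X × ℝ≥0) :
    Q.instrKernel N t d = Q.instr (t + 1) (fun i => (d t i).1) fun i => (d t i).2 := rfl

instance (Q : Proposal H) (t : ℕ) : IsFiniteKernel (Q.instrKernel N t) :=
  ⟨1, ENNReal.one_lt_top, fun d => by
    rw [instrKernel_apply, instr_univ]
    exact ENNReal.inv_mul_le_one _⟩

/-- The contribution `ω_{t+1} T_{t+1}[k](x')` to the unnormalized estimator of time `t + 1` of a new
particle `x' = p.2` with ancestor index `p.1`, where `T_{t+1}` is the backward mean through the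
cloud `d`. -/
noncomputable def contribution (Q : Proposal H) (d : ℕ → Fin N → X × ℝ≥0) (t : ℕ)
    (k : (Fin (t + 2) → X) → ℝ) (p : Fin N × X) : ℝ :=
  Q.w (t + 1) (d t p.1).1 p.2 * H.backwardMean d (t + 1) p.2 k

lemma measurable_contribution (Q : Proposal H) {k : (Fin (t + 2) → X) → ℝ} (hk : Measurable k) :
    Measurable (Function.uncurry fun (d : ℕ → Fin N → X × ℝ≥0) p => Q.contribution d t k p) := by
  have hancestor : Measurable fun q : Fin N × (ℕ → Fin N → X × ℝ≥0) => (q.2 t q.1).1 :=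
    measurable_from_prod_countable_right fun i => by dsimp only; fun_prop
  refine Measurable.mul (Measurable.coe_nnreal_real ?_) (HMM.measurable_backwardMean measurable_fst
    (measurable_snd.comp measurable_snd) (hk.comp measurable_snd))
  exact (Q.measurable_w (t + 1)).comp ((hancestor.comp
    ((measurable_fst.comp measurable_snd).prodMk measurable_fst)).prodMk
      (measurable_snd.comp measurable_snd))

/-- Bounds, up to the horizon `T`, on the adjustment multipliers and the importance weights. A
single constant is used for all of them. -/
structure BoundedBy (Q : Proposal H) (T : ℕ) (K : ℝ≥0) : Prop where
  pos : 0 < K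
  ϑ_le : ∀ t < T, ∀ x, Q.ϑ (t + 1) x ≤ K
  w₀_le : ∀ᵐ x ∂Q.ρ₀, Q.w₀ x ≤ K
  w_le : ∀ t < T, ∀ x x', Q.w (t + 1) x x' ≤ K

namespace BoundedBy

variable {Q : Proposal H}

lemma regular (hQ : Q.BoundedBy T K) (hT : H.evidence T ≠ 0) : H.Regular T (K ^ 2) where
  evidence_ne_zero_last := hT
  evidence_zero_ne_top := by
    have hw₀ : H.evidence 0 = ∫⁻ x, Q.w₀ x ∂Q.ρ₀ := by
      rw [HMM.evidence_zero, ← setLIntegral_univ, ← withDensity_apply _ .univ,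
        ← Q.ρ₀_withDensity_w₀, withDensity_apply _ .univ, setLIntegral_univ]
    rw [hw₀]
    refine ((lintegral_mono_ae (g := fun _ => (K : ℝ≥0∞)) ?_).trans_lt ?_).ne
    · filter_upwards [hQ.w₀_le] with x hx using by exact_mod_cast hx
    · simp
  MG_univ_le t ht x := by
    rw [← Q.smul_R_withDensity_w, Measure.smul_apply, ENNReal.smul_def, smul_eq_mul,
      withDensity_apply _ .univ, setLIntegral_univ]
    calc (Q.ϑ (t + 1) x : ℝ≥0∞) * ∫⁻ x', Q.w (t + 1) x x' ∂Q.R (t + 1) x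
        ≤ K * ∫⁻ _, K ∂Q.R (t + 1) x := by
          gcongr with x'
          · exact hQ.ϑ_le t ht x
          · exact hQ.w_le t ht x x'
      _ = (K ^ 2 : ℝ≥0) := by simp [sq]

lemma abs_contribution_le (hQ : Q.BoundedBy T K) (ht : t < T) {k : (Fin (t + 2) → X) → ℝ} {c : ℝ}
    (hc : 0 ≤ c) (hk : ∀ z, |k z| ≤ c) (d : ℕ → Fin N → X × ℝ≥0) (p : Fin N × X) :
    |Q.contribution d t k p| ≤ K * c := by
  rw [contribution, abs_mul, NNReal.abs_eq]
  gcongr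
  · exact hQ.w_le t ht _ _
  · exact HMM.abs_backwardMean_le hc hk

lemma abs_integral_contribution_le (hQ : Q.BoundedBy T K) (ht : t < T)
    {k : (Fin (t + 2) → X) → ℝ} {c : ℝ} {d : ℕ → Fin N → X × ℝ≥0} (hd : 0 < ∑ i, (d t i).2)
    (hc : 0 ≤ c) (hkc : ∀ z, |k z| ≤ c) :
    |∫ p, Q.contribution d t k p ∂Q.instrKernel N t d| ≤ K * c := by
  have : IsProbabilityMeasure (Q.instrKernel N t d) := Q.isProbabilityMeasure_instr _ _ hd
  simpa using norm_integral_le_of_norm_le_const (f := Q.contribution d t k)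
    (ae_of_all (Q.instrKernel N t d) (hQ.abs_contribution_le ht hc hkc d))

/-- Time reversal of the pair (ancestor, particle) turns the backward mean into a forward step. -/
lemma integral_contribution_mul_est (hQ : Q.BoundedBy T K) (hT : H.evidence T ≠ 0) (ht : t < T)
    {d : ℕ → Fin N → X × ℝ≥0} (hd : H.Reachable d t) (hpos : 0 < ∑ i, (d t i).2)
    {k : (Fin (t + 2) → X) → ℝ} (hk : Measurable k) {c : ℝ} (hc : 0 ≤ c) (hkc : ∀ z, |k z| ≤ c) :
    (∫ p, Q.contribution d t k p ∂Q.instrKernel N t d) *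
        H.est d t (fun z => Q.ϑ (t + 1) (z (Fin.last t))) = H.est d t (H.fwd t k) := by
  have := (hQ.regular hT).isFiniteMeasure_MG ht
  have hϑ := Q.sum_mul_ϑ_pos (t + 1) (fun i => (d t i).1) hpos
  have hm : Measurable (Q.contribution d t k) :=
    (Q.measurable_contribution hk).comp measurable_prodMk_left
  rw [instrKernel_apply, integral_instr _ _ _ _ hm fun i => .of_bound
    (hm.comp measurable_prodMk_left).aestronglyMeasurable _
    (ae_of_all _ fun x => hQ.abs_contribution_le ht hc hkc d (i, x))]
  simp only [contribution, mul_assoc, integral_w_mul]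
  rw [HMM.sum_mul_integral_backwardMean hk hkc, HMM.est_apply, HMM.est_apply,
    HMM.unnormEst_last hd fun x => (Q.ϑ (t + 1) x : ℝ)]
  have hϑ' : ∑ i, ((d t i).2 : ℝ) * Q.ϑ (t + 1) (d t i).1 ≠ 0 := by exact_mod_cast hϑ.ne'
  field_simp

end BoundedBy

lemma predDensity_pos (Q : Proposal H) {d : ℕ → Fin N → X × ℝ≥0} {i : Fin N} {x : X}
    (hi : 0 < (d t i).2) (hw : 0 < Q.w (t + 1) (d t i).1 x) : 0 < H.predDensity d t x := by
  have hm : 0 < H.m (d t i).1 x := by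
    rw [pos_iff_ne_zero]
    intro hm
    simp [w, hm] at hw
  exact Finset.sum_pos' (fun _ _ => by positivity)
    ⟨i, Finset.mem_univ i, mul_pos (by exact_mod_cast hi) (by exact_mod_cast hm)⟩

variable {Q : Proposal H}

/-- The limit `b_t` of the mean weight `N⁻¹ ∑ ω_t^i` as `N → ∞`, in terms of the evidences `Z_t`:
`b_0 = Z_0` and `b_{t+1} = (Z_{t+1} / Z_t) / φ_t(ϑ_{t+1})`. -/
noncomputable def weightMean (Q : Proposal H) : ℕ → ℝ
  | 0 => (H.evidence 0).toReal
  | t + 1 => (H.evidence (t + 1) / H.evidence t).toReal / ∫ x, (Q.ϑ (t + 1) x : ℝ) ∂H.filt t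

namespace BoundedBy

lemma integral_ϑ_pos (hQ : Q.BoundedBy T K) (hT : H.evidence T ≠ 0) (ht : t < T) :
    0 < ∫ x, (Q.ϑ (t + 1) x : ℝ) ∂H.filt t := by
  have := (hQ.regular hT).isProbabilityMeasure_filt ht.le
  have hint : Integrable (fun x => (Q.ϑ (t + 1) x : ℝ)) (H.filt t) :=
    .of_bound (Q.measurable_ϑ (t + 1)).coe_nnreal_real.aestronglyMeasurable K
      (ae_of_all _ fun x => by simpa using hQ.ϑ_le t ht x)
  rw [integral_pos_iff_support_of_nonneg (fun _ => NNReal.coe_nonneg _) hint]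
  have hsupp : (Function.support fun x => (Q.ϑ (t + 1) x : ℝ)) = Set.univ :=
    Set.eq_univ_of_forall fun x => NNReal.coe_ne_zero.2 (Q.ϑ_pos (t + 1) x).ne'
  rw [hsupp, measure_univ]
  exact one_pos

lemma weightMean_pos (hQ : Q.BoundedBy T K) (hT : H.evidence T ≠ 0) (ht : t ≤ T) :
    0 < Q.weightMean t := by
  have h := hQ.regular hT
  cases t with
  | zero => exact ENNReal.toReal_pos (h.evidence_ne_zero ht) (h.evidence_ne_top ht)
  | succ t => exact div_pos (h.evidence_ratio_pos ht) (hQ.integral_ϑ_pos hT ht)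

lemma integral_fwd (hQ : Q.BoundedBy T K) (hT : H.evidence T ≠ 0) (ht : t < T)
    {k : (Fin (t + 2) → X) → ℝ} (hk : Measurable k) {a : ℝ} (hka : ∀ z, |k z| ≤ a) :
    ∫ z, H.fwd t k z ∂H.smooth t =
      (∫ x, (Q.ϑ (t + 1) x : ℝ) ∂H.filt t) *
        (Q.weightMean (t + 1) * ∫ z, k z ∂H.smooth (t + 1)) := by
  have h := hQ.regular hT
  have := h.isProbabilityMeasure_smooth ht
  rw [HMM.integral_fwd (h.evidence_ne_zero ht) (h.evidence_ne_top ht) (h.evidence_ne_zero ht.le)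
    (.of_bound hk.aestronglyMeasurable a (ae_of_all _ hka)), weightMean, ← mul_assoc,
    mul_div_cancel₀ _ (hQ.integral_ϑ_pos hT ht).ne']

end BoundedBy

end Proposal

/-! ### The conditional law of a generation of particles -/

namespace ParticleSystem

variable {X Y : Type*} [MeasurableSpace X] [MeasurableSpace Y] {H : HMM X Y} {Q : Proposal H}
  {t T N : ℕ} {Ω : Type*} [MeasurableSpace Ω] {P : Measure Ω} {K : ℝ≥0}

/-- The event that the total weight is positive at each time `s < t`, on which the law of the
generations up to time `t` is prescribed. -/
def aliveBefore (S : ParticleSystem Q T N P) (t : ℕ) : Set Ω :=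
  {ω | ∀ s < t, 0 < ∑ i, S.weight s i ω}

/-- The weighted particle cloud stopped at time `t`: the generations after time `t` are replaced
by generation `t`, which makes it a function of the particles and weights up to time `t`. -/
noncomputable def past (S : ParticleSystem Q T N P) (t : ℕ) (ω : Ω) (s : ℕ) (i : Fin N) :
    X × ℝ≥0 :=
  S.cloud ω (min s t) i

/-- The information contained in the particles and weights up to time `t`. -/
noncomputable abbrev history (S : ParticleSystem Q T N P) (t : ℕ) : MeasurableSpace Ω :=
  ⨆ s ≤ t, ⨆ i, MeasurableSpace.comap (fun ω => (S.ξ s i ω, S.weight s i ω)) inferInstance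

lemma alive_eq_aliveBefore (S : ParticleSystem Q T N P) : S.alive = S.aliveBefore (T + 1) :=
  Set.ext fun _ => forall_congr' fun _ => by rw [Nat.lt_succ_iff]

lemma aliveBefore_anti (S : ParticleSystem Q T N P) : Antitone S.aliveBefore :=
  fun _ _ hst _ hω u hu => hω u (hu.trans_le hst)

lemma measurable_weight (S : ParticleSystem Q T N P) (s : ℕ) (i : Fin N) :
    Measurable (S.weight s i) := by
  cases s with
  | zero => exact Q.measurable_w₀.comp (S.measurable_ξ 0 i)
  | succ s =>
    have hξ : Measurable fun p : Fin N × Ω => S.ξ s p.1 p.2 :=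
      measurable_from_prod_countable_right fun j => S.measurable_ξ s j
    exact (Q.measurable_w (s + 1)).comp ((hξ.comp ((S.measurable_I (s + 1) i).prodMk
      measurable_id)).prodMk (S.measurable_ξ (s + 1) i))

lemma measurableSet_aliveBefore (S : ParticleSystem Q T N P) (t : ℕ) :
    MeasurableSet (S.aliveBefore t) := by
  have heq : S.aliveBefore t = ⋂ s ∈ Set.Iio t, {ω | 0 < ∑ i, S.weight s i ω} := by
    ext ω
    simp [aliveBefore]
  rw [heq]
  exact .biInter (Set.to_countable _) fun s _ => measurableSet_lt measurable_const
    (Finset.measurable_sum _ fun i _ => S.measurable_weight s i)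

lemma past_of_le (S : ParticleSystem Q T N P) {s : ℕ} (hst : s ≤ t) (ω : Ω) :
    S.past t ω s = S.cloud ω s :=
  funext fun i => by rw [past, min_eq_left hst]

lemma measurable_past_history (S : ParticleSystem Q T N P) (t : ℕ) :
    Measurable[S.history t] (S.past t) := by
  refine @measurable_pi_lambda _ _ _ (S.history t) _ _ fun s => ?_
  refine @measurable_pi_lambda _ _ _ (S.history t) _ _ fun i => ?_
  exact (comap_measurable _).mono
    (le_iSup₂_of_le (min s t) (min_le_right s t) (le_iSup_of_le i le_rfl)) le_rfl

lemma measurable_past (S : ParticleSystem Q T N P) (t : ℕ) : Measurable (S.past t) :=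
  measurable_pi_lambda _ fun _ => measurable_pi_lambda _ fun _ =>
    (S.measurable_ξ _ _).prodMk (S.measurable_weight _ _)

lemma measurableSet_history_aliveBefore (S : ParticleSystem Q T N P) (t : ℕ) :
    MeasurableSet[S.history t] (S.aliveBefore (t + 1)) := by
  have heq : S.aliveBefore (t + 1) =
      S.past t ⁻¹' ⋂ s ∈ Set.Iic t, {d | 0 < ∑ i, (d s i).2} := by
    ext ω
    simp only [aliveBefore, Nat.lt_succ_iff, Set.mem_preimage, Set.mem_iInter, Set.mem_Iic,
      Set.mem_ofPred_eq]
    exact forall₂_congr fun s hs => by rw [S.past_of_le hs]; rfl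
  rw [heq]
  exact S.measurable_past_history t (.biInter (Set.to_countable _) fun s _ =>
    measurableSet_lt measurable_const (by fun_prop))

lemma map_past_prodMk [IsFiniteMeasure P] (S : ParticleSystem Q T N P) (ht : t < T) :
    (P.restrict (S.aliveBefore (t + 1))).map
        (fun ω => (S.past t ω, fun i => (S.I (t + 1) i ω, S.ξ (t + 1) i ω))) =
      (P.restrict (S.aliveBefore (t + 1))).map (S.past t) ⊗ₘ
        iidKernel (Fin N) (Q.instrKernel N t) := by
  refine map_prodMk_eq_compProd_iidKernel (S.measurable_past t)
    (fun i => (S.measurable_I _ i).prodMk (S.measurable_ξ _ i)) fun U hU A hA => ?_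
  have hstep := S.law_step t ht (S.past t ⁻¹' U ∩ S.aliveBefore (t + 1))
    ((S.measurable_past_history t hU).inter (S.measurableSet_history_aliveBefore t))
    (fun ω hω s hs => hω.2 s (Nat.lt_succ_of_le hs)) A hA
  rw [Measure.restrict_apply' (S.measurableSet_aliveBefore _), Set.inter_right_comm, hstep,
    Measure.restrict_restrict (S.measurable_past t hU)]
  simp only [Proposal.instrKernel_apply, S.past_of_le le_rfl]
  rfl

lemma ae_ancestor_weight_pos [IsFiniteMeasure P] (S : ParticleSystem Q T N P) (ht : t < T) :
    ∀ᵐ ω ∂P.restrict (S.aliveBefore (t + 1)), ∀ i, 0 < S.weight t (S.I (t + 1) i ω) ω := by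
  have hsnd : Measurable fun q : Fin N × (ℕ → Fin N → X × ℝ≥0) => (q.2 t q.1).2 :=
    measurable_from_prod_countable_right fun i => by dsimp only; fun_prop
  have hS : MeasurableSet
      {q : (ℕ → Fin N → X × ℝ≥0) × (Fin N × X) | 0 < (q.1 t q.2.1).2} :=
    measurableSet_lt measurable_const
      (hsnd.comp ((measurable_fst.comp measurable_snd).prodMk measurable_fst))
  filter_upwards [ae_forall_mem_of_map_eq_compProd_iidKernel (S.measurable_past t)
    (fun i => (S.measurable_I _ i).prodMk (S.measurable_ξ _ i)) (S.map_past_prodMk ht) hS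
    fun d => Q.ae_instr_weight_pos (t + 1) _ _] with ω hω i
  simpa only [Set.mem_ofPred_eq, S.past_of_le le_rfl] using! hω i

lemma ae_reachable [IsFiniteMeasure P] (S : ParticleSystem Q T N P) (ht : t ≤ T) :
    ∀ᵐ ω ∂P.restrict (S.aliveBefore t), H.Reachable (S.cloud ω) t := by
  have hanc : ∀ s, ∀ᵐ ω ∂P.restrict (S.aliveBefore t), s < t →
      ∀ i, 0 < S.weight s (S.I (s + 1) i ω) ω := by
    intro s
    rcases lt_or_ge s t with hs | hs
    · filter_upwards [ae_restrict_of_ae_restrict_of_subset (S.aliveBefore_anti hs)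
        (S.ae_ancestor_weight_pos (hs.trans_le ht))] with ω hω _ using hω
    · exact ae_of_all _ fun ω h => absurd h hs.not_gt
  filter_upwards [ae_all_iff.2 hanc] with ω hω s hs i hi
  exact Q.predDensity_pos (hω s hs i) hi

lemma ae_reachable_and_weight_pos [IsFiniteMeasure P] (S : ParticleSystem Q T N P) (ht : t ≤ T) :
    ∀ᵐ ω ∂P.restrict (S.aliveBefore (t + 1)),
      H.Reachable (S.cloud ω) t ∧ 0 < ∑ i, (S.cloud ω t i).2 := by
  filter_upwards [ae_restrict_of_ae_restrict_of_subset (S.aliveBefore_anti t.le_succ)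
    (S.ae_reachable ht), ae_restrict_mem (S.measurableSet_aliveBefore (t + 1))] with ω hω hal
  exact ⟨hω, hal t t.lt_succ_self⟩

lemma unnormEst_cloud_zero (S : ParticleSystem Q T N P) (k : (Fin 1 → X) → ℝ) (ω : Ω) :
    H.unnormEst (S.cloud ω) 0 k = ∑ i, (Q.w₀ (S.ξ 0 i ω) : ℝ) * k fun _ => S.ξ 0 i ω :=
  HMM.unnormEst_apply k

lemma unnormEst_cloud_succ (S : ParticleSystem Q T N P) (k : (Fin (t + 2) → X) → ℝ) (ω : Ω) :
    H.unnormEst (S.cloud ω) (t + 1) k =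
      ∑ i, Q.contribution (S.cloud ω) t k (S.I (t + 1) i ω, S.ξ (t + 1) i ω) :=
  HMM.unnormEst_apply k

lemma hasSubgaussianTail_unnormEst_sub_integral_contribution [IsProbabilityMeasure P] [NeZero N]
    (S : ParticleSystem Q T N P) (hQ : Q.BoundedBy T K) (ht : t < T)
    {k : (Fin (t + 2) → X) → ℝ} (hk : Measurable k) {a : ℝ} (ha : 0 < a) (hka : ∀ z, |k z| ≤ a) :
    HasSubgaussianTail (P.restrict (S.aliveBefore (t + 1)))
      (fun ω => (N : ℝ)⁻¹ * H.unnormEst (S.cloud ω) (t + 1) k -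
        ∫ p, Q.contribution (S.cloud ω) t k p ∂Q.instrKernel N t (S.cloud ω))
      2 (N / (2 * (K * a) ^ 2)) := by
  have hpast : ∀ ω, Q.contribution (S.past t ω) t k = Q.contribution (S.cloud ω) t k ∧
      Q.instrKernel N t (S.past t ω) = Q.instrKernel N t (S.cloud ω) := fun ω => by
    refine ⟨funext fun p => ?_, ?_⟩
    · rw [Proposal.contribution, S.past_of_le le_rfl,
        HMM.backwardMean_congr fun s hs => S.past_of_le (Nat.le_of_lt_succ hs) ω]
      rfl
    · rw [Proposal.instrKernel_apply, S.past_of_le le_rfl]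
      rfl
  have hκ : ∀ᵐ ω ∂P.restrict (S.aliveBefore (t + 1)),
      IsProbabilityMeasure (Q.instrKernel N t (S.past t ω)) := by
    filter_upwards [ae_restrict_mem (S.measurableSet_aliveBefore (t + 1))] with ω hω
    rw [(hpast ω).2]
    exact Q.isProbabilityMeasure_instr _ _ (hω t t.lt_succ_self)
  have htail := hasSubgaussianTail_average_of_map_eq_compProd_iidKernel (S.measurable_past t)
    (fun i => (S.measurable_I _ i).prodMk (S.measurable_ξ _ i)) (S.map_past_prodMk ht) hκ
    (Q.measurable_contribution hk) (mul_pos (NNReal.coe_pos.2 hQ.pos) ha)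
    (hQ.abs_contribution_le ht ha.le hka)
  simp only [Fintype.card_fin, hpast, ← S.unnormEst_cloud_succ] at htail
  refine htail.mono (mul_le_of_le_one_right two_pos.le ?_) le_rfl
  rw [measureReal_restrict_apply_univ]
  exact measureReal_le_one

/-- Exponential deviation inequality at time `t` for the unnormalized estimator, uniformly over
test functions bounded by a given constant. Only the rate depends on the number of particles. -/
def UnnormEstConcentrates (S : ParticleSystem Q T N P) (t : ℕ) (B C : ℝ) : Prop :=
  ∀ k : (Fin (t + 1) → X) → ℝ, Measurable k → ∀ a > 0, (∀ z, |k z| ≤ a) →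
    HasSubgaussianTail (P.restrict (S.aliveBefore t))
      (fun ω => (N : ℝ)⁻¹ * H.unnormEst (S.cloud ω) t k - Q.weightMean t * ∫ z, k z ∂H.smooth t)
      B (C * N / a ^ 2)

/-- Exponential deviation inequality at time `t` for the smoothing estimator, uniformly over test
functions bounded by a given constant. -/
def EstConcentrates (S : ParticleSystem Q T N P) (t : ℕ) (B C : ℝ) : Prop :=
  ∀ k : (Fin (t + 1) → X) → ℝ, Measurable k → ∀ a > 0, (∀ z, |k z| ≤ a) →
    HasSubgaussianTail (P.restrict (S.aliveBefore (t + 1)))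
      (fun ω => H.est (S.cloud ω) t k - ∫ z, k z ∂H.smooth t) B (C * N / a ^ 2)

lemma unnormEstConcentrates_zero [IsProbabilityMeasure P] [NeZero N] (S : ParticleSystem Q T N P)
    (hQ : Q.BoundedBy T K) (hT : H.evidence T ≠ 0) :
    S.UnnormEstConcentrates 0 2 (1 / (2 * K ^ 2)) := by
  intro k hk a ha hka
  have hconst : Measurable fun (x : X) (_ : Fin 1) => x := by fun_prop
  have hm : Measurable fun x : X => (Q.w₀ x : ℝ) * k (fun _ => x) :=
    Q.measurable_w₀.coe_nnreal_real.mul (hk.comp hconst)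
  have hbound : ∀ᵐ x ∂Q.ρ₀, |(Q.w₀ x : ℝ) * k (fun _ => x)| ≤ K * a := by
    filter_upwards [hQ.w₀_le] with x hx
    rw [abs_mul, NNReal.abs_eq]
    gcongr
    exact hka _
  have hmean : ∫ x, (Q.w₀ x : ℝ) * k (fun _ => x) ∂Q.ρ₀ =
      Q.weightMean 0 * ∫ z, k z ∂H.smooth 0 := by
    have h := hQ.regular hT
    have hZ : (H.evidence 0).toReal ≠ 0 := ENNReal.toReal_ne_zero.2
      ⟨h.evidence_ne_zero T.zero_le, h.evidence_ne_top T.zero_le⟩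
    rw [Q.integral_w₀_mul, HMM.smooth, integral_smul_measure, ENNReal.toReal_inv,
      Proposal.weightMean, smul_eq_mul, ← HMM.evidence, mul_inv_cancel_left₀ hZ,
      HMM.unnormSmooth_zero, integral_map hconst.aemeasurable hk.aestronglyMeasurable]
  have htail := hasSubgaussianTail_average
    (S.indep_init.comp (fun _ x => (Q.w₀ x : ℝ) * k (fun _ => x)) fun _ => hm)
    (fun i => (hm.comp (S.measurable_ξ 0 i)).aemeasurable)
    (mul_pos (NNReal.coe_pos.2 hQ.pos) ha)
    (fun i => ae_of_ae_map (S.measurable_ξ 0 i).aemeasurable (by rwa [S.law_init i]))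
    (a := Q.weightMean 0 * ∫ z, k z ∂H.smooth 0) fun i => by
      rw [← hmean, ← S.law_init i,
        integral_map (S.measurable_ξ 0 i).aemeasurable hm.aestronglyMeasurable]
      rfl
  rw [Fintype.card_fin] at htail
  have hrate : 1 / (2 * (K : ℝ) ^ 2) * N / a ^ 2 = N / (2 * (K * a) ^ 2) := by ring
  simp only [S.unnormEst_cloud_zero, hrate]
  exact htail.mono_measure Measure.restrict_le_self

end ParticleSystem

/-! ### Exponential concentration -/

universe u

namespace ParticleSystem

variable {X Y : Type*} [MeasurableSpace X] [MeasurableSpace Y] {H : HMM X Y} {Q : Proposal H}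
  {t T N : ℕ} {Ω : Type*} [MeasurableSpace Ω] {P : Measure Ω} {K : ℝ≥0}

lemma UnnormEstConcentrates.estConcentrates [IsFiniteMeasure P]
    {S : ParticleSystem Q T N P} {B C : ℝ} (hQ : Q.BoundedBy T K) (hT : H.evidence T ≠ 0)
    (ht : t ≤ T) (h : S.UnnormEstConcentrates t B C) :
    S.EstConcentrates t (2 * B) (C * Q.weightMean t ^ 2 / 4) := by
  intro k hk a ha hka
  have := (hQ.regular hT).isProbabilityMeasure_smooth ht
  have hb := hQ.weightMean_pos hT ht
  set b := Q.weightMean t with hb_def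
  have hmono := Measure.restrict_mono_set P (S.aliveBefore_anti t.le_succ)
  have htail_k := (h k hk a ha hka).mono_measure hmono
  have htail_one := (((h 1 measurable_const 1 one_pos (by simp)).mono_measure hmono).of_abs_le_mul
    (W := fun ω => a * ((N : ℝ)⁻¹ * H.unnormEst (S.cloud ω) t 1 - b)) ha
    (ae_of_all _ fun ω => by simp [hb_def, abs_mul, abs_of_pos ha]))
  have hdev := htail_k.of_abs_le_add htail_one
    (W := fun ω => b * (H.est (S.cloud ω) t k - ∫ z, k z ∂H.smooth t)) ?_
  · refine (hdev.of_abs_le_mul (inv_pos.2 hb) (ae_of_all _ fun ω => ?_)).mono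
      (two_mul B).ge (le_of_eq ?_)
    · rw [abs_mul, abs_of_pos hb, inv_mul_cancel_left₀ hb.ne']
    · rw [one_pow, div_one, min_self]
      field_simp
  · filter_upwards [S.ae_reachable_and_weight_pos ht] with ω ⟨hd, hpos⟩
    have hw : (∑ l, ((S.cloud ω t l).2 : ℝ)) ≠ 0 := by exact_mod_cast hpos.ne'
    have hU : H.unnormEst (S.cloud ω) t k =
        H.unnormEst (S.cloud ω) t 1 * H.est (S.cloud ω) t k := by
      rw [HMM.est_apply, HMM.unnormEst_one hd, mul_inv_cancel_left₀ hw]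
    calc |b * (H.est (S.cloud ω) t k - ∫ z, k z ∂H.smooth t)|
        = |((N : ℝ)⁻¹ * H.unnormEst (S.cloud ω) t k - b * ∫ z, k z ∂H.smooth t) -
            H.est (S.cloud ω) t k * ((N : ℝ)⁻¹ * H.unnormEst (S.cloud ω) t 1 - b)| := by
          rw [hU]
          ring_nf
      _ ≤ _ := (abs_sub _ _).trans (by
          rw [abs_mul (H.est _ _ _), abs_mul a, abs_of_pos ha]
          gcongr
          exact HMM.abs_est_le ha.le hka)

lemma EstConcentrates.est_ϑ {S : ParticleSystem Q T N P} {B C : ℝ} (hQ : Q.BoundedBy T K)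
    (ht : t < T) (h : S.EstConcentrates t B C) :
    HasSubgaussianTail (P.restrict (S.aliveBefore (t + 1)))
      (fun ω => H.est (S.cloud ω) t (fun z => Q.ϑ (t + 1) (z (Fin.last t))) -
        ∫ x, (Q.ϑ (t + 1) x : ℝ) ∂H.filt t) B (C * N / K ^ 2) := by
  have hϑ : Measurable fun x => (Q.ϑ (t + 1) x : ℝ) := (Q.measurable_ϑ _).coe_nnreal_real
  rw [HMM.integral_filt hϑ]
  exact h _ (hϑ.comp (measurable_pi_apply _)) K (NNReal.coe_pos.2 hQ.pos) fun z => by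
    simpa using hQ.ϑ_le t ht _

/-- The conditional mean of the new contributions is a ratio of two estimators of time `t`, one for
the forward step of `k` and one for the adjustment multiplier. -/
lemma EstConcentrates.integral_contribution [IsFiniteMeasure P] {S : ParticleSystem Q T N P}
    {B C : ℝ} (hQ : Q.BoundedBy T K) (hT : H.evidence T ≠ 0) (ht : t < T)
    (h : S.EstConcentrates t B C) {k : (Fin (t + 2) → X) → ℝ} (hk : Measurable k) {a : ℝ}
    (ha : 0 < a) (hka : ∀ z, |k z| ≤ a) :
    HasSubgaussianTail (P.restrict (S.aliveBefore (t + 1)))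
      (fun ω => ∫ p, Q.contribution (S.cloud ω) t k p ∂Q.instrKernel N t (S.cloud ω) -
        Q.weightMean (t + 1) * ∫ z, k z ∂H.smooth (t + 1))
      (2 * B) (C * (∫ x, (Q.ϑ (t + 1) x : ℝ) ∂H.filt t) ^ 2 / (4 * K ^ 4) * N / a ^ 2) := by
  set θ := ∫ x, (Q.ϑ (t + 1) x : ℝ) ∂H.filt t with hθ_def
  set m := Q.weightMean (t + 1) * ∫ z, k z ∂H.smooth (t + 1) with hm_def
  have hθ : 0 < θ := hQ.integral_ϑ_pos hT ht
  have hK : (0 : ℝ) < K := NNReal.coe_pos.2 hQ.pos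
  have hKa : 0 < K * a := mul_pos hK ha
  have htail_fwd := h (H.fwd t k) (HMM.measurable_fwd hk) (a * (K ^ 2 : ℝ≥0))
    (mul_pos ha (NNReal.coe_pos.2 (pow_pos hQ.pos 2))) ((hQ.regular hT).abs_fwd_le ht ha.le hka)
  have htail_ϑ := (h.est_ϑ hQ ht).of_abs_le_mul hKa (ae_of_all _ fun ω => by
    rw [abs_mul, abs_of_pos hKa]) (W := fun ω => K * a *
      (H.est (S.cloud ω) t (fun z => Q.ϑ (t + 1) (z (Fin.last t))) - θ))
  have hdev := htail_fwd.of_abs_le_add htail_ϑ (W := fun ω =>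
    θ * (∫ p, Q.contribution (S.cloud ω) t k p ∂Q.instrKernel N t (S.cloud ω) - m)) ?_
  · refine (hdev.of_abs_le_mul (inv_pos.2 hθ) (ae_of_all _ fun ω => ?_)).mono
      (two_mul B).ge (le_of_eq ?_)
    · rw [abs_mul, abs_of_pos hθ, inv_mul_cancel_left₀ hθ.ne']
    · have hrate : C * N / (a * (K ^ 2 : ℝ≥0)) ^ 2 = C * N / K ^ 2 / (K * a) ^ 2 := by
        push_cast
        field_simp
      rw [hrate, min_self]
      field_simp
  · filter_upwards [S.ae_reachable_and_weight_pos ht.le] with ω ⟨hd, hpos⟩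
    set c := ∫ p, Q.contribution (S.cloud ω) t k p ∂Q.instrKernel N t (S.cloud ω)
    have hc : c * H.est (S.cloud ω) t (fun z => Q.ϑ (t + 1) (z (Fin.last t))) =
        H.est (S.cloud ω) t (H.fwd t k) :=
      hQ.integral_contribution_mul_est hT ht hd hpos hk ha.le hka
    have hc_le : |c| ≤ K * a := hQ.abs_integral_contribution_le ht hpos ha.le hka
    calc |θ * (c - m)| = |(H.est (S.cloud ω) t (H.fwd t k) - ∫ z, H.fwd t k z ∂H.smooth t) -
            c * (H.est (S.cloud ω) t (fun z => Q.ϑ (t + 1) (z (Fin.last t))) - θ)| := by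
          rw [hQ.integral_fwd hT ht hk hka, ← hc, ← hθ_def, ← hm_def]
          ring_nf
      _ ≤ _ := (abs_sub _ _).trans (by
          rw [abs_mul c, abs_mul (K * a), abs_of_pos hKa]
          gcongr)

lemma EstConcentrates.unnormEstConcentrates [IsProbabilityMeasure P] [NeZero N]
    {S : ParticleSystem Q T N P} {B C : ℝ} (hQ : Q.BoundedBy T K) (hT : H.evidence T ≠ 0)
    (ht : t < T) (h : S.EstConcentrates t B C) :
    S.UnnormEstConcentrates (t + 1) (2 + 2 * B)
      (min (1 / (2 * (K : ℝ) ^ 2))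
        (C * (∫ x, (Q.ϑ (t + 1) x : ℝ) ∂H.filt t) ^ 2 / (4 * K ^ 4)) / 4) := by
  intro k hk a ha hka
  refine ((S.hasSubgaussianTail_unnormEst_sub_integral_contribution hQ ht hk ha hka).of_abs_le_add
    (h.integral_contribution hQ hT ht hk ha hka)
    (ae_of_all _ fun ω => abs_sub_le _ _ _)).mono le_rfl (le_of_eq ?_)
  have hrate : (N : ℝ) / (2 * (K * a) ^ 2) = 1 / (2 * K ^ 2) * N / a ^ 2 := by ring
  rw [hrate, mul_div_assoc _ (N : ℝ), mul_div_assoc _ (N : ℝ), mul_div_assoc _ (N : ℝ),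
    ← min_mul_of_nonneg _ _ (by positivity), div_mul_eq_mul_div]

lemma exists_unnormEstConcentrates (hQ : Q.BoundedBy T K) (hT : H.evidence T ≠ 0) (ht : t ≤ T) :
    ∃ B C : ℝ, 0 < B ∧ 0 < C ∧ ∀ (Ω : Type u) [MeasurableSpace Ω] (P : Measure Ω)
      [IsProbabilityMeasure P] (N : ℕ) [NeZero N] (S : ParticleSystem Q T N P),
        S.UnnormEstConcentrates t B C := by
  have hK : (0 : ℝ) < K := NNReal.coe_pos.2 hQ.pos
  induction t with
  | zero => exact ⟨2, _, two_pos, by positivity,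
      fun Ω _ P _ N _ S => S.unnormEstConcentrates_zero hQ hT⟩
  | succ t ih =>
    obtain ⟨B, C, hB, hC, h⟩ := ih (t.le_succ.trans ht)
    have hb := hQ.weightMean_pos hT (t.le_succ.trans ht)
    have hθ := hQ.integral_ϑ_pos hT ht
    exact ⟨_, _, by positivity, by positivity, fun Ω _ P _ N _ S =>
      ((h Ω P N S).estConcentrates hQ hT (t.le_succ.trans ht)).unnormEstConcentrates hQ hT ht⟩

lemma UnnormEstConcentrates.measureReal_weight_eq_zero_le [IsFiniteMeasure P]
    {S : ParticleSystem Q T N P} {B C : ℝ} (hQ : Q.BoundedBy T K) (hT : H.evidence T ≠ 0)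
    (ht : t ≤ T) (h : S.UnnormEstConcentrates t B C) :
    P.real (S.aliveBefore t \ S.aliveBefore (t + 1)) ≤
      B * Real.exp (-(C * Q.weightMean t ^ 2 * N)) := by
  have := (hQ.regular hT).isProbabilityMeasure_smooth ht
  have hb := hQ.weightMean_pos hT ht
  have htail := h 1 measurable_const 1 one_pos (by simp) (Q.weightMean t) hb
  have hsub : S.aliveBefore t \ S.aliveBefore (t + 1) ⊆ {ω | Q.weightMean t ≤
      |(N : ℝ)⁻¹ * H.unnormEst (S.cloud ω) t 1 - Q.weightMean t *
        ∫ z, (1 : (Fin (t + 1) → X) → ℝ) z ∂H.smooth t|} ∩ S.aliveBefore t := by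
    rintro ω ⟨hal, hdead⟩
    refine ⟨?_, hal⟩
    have hzero : ∀ i, (S.cloud ω t i).2 = 0 := by
      by_contra! ⟨i, hi⟩
      refine hdead fun s hs => ?_
      rcases (Nat.lt_succ_iff.1 hs).lt_or_eq with hs | rfl
      · exact hal s hs
      · exact Finset.sum_pos' (fun _ _ => by positivity)
          ⟨i, Finset.mem_univ i, pos_iff_ne_zero.2 hi⟩
    simp [HMM.unnormEst_apply, hzero, abs_of_pos hb]
  calc P.real (S.aliveBefore t \ S.aliveBefore (t + 1))
      ≤ (P.restrict (S.aliveBefore t)).real _ := by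
        rw [measureReal_restrict_apply' (S.measurableSet_aliveBefore t)]
        exact measureReal_mono hsub
    _ ≤ _ := htail
    _ = _ := by ring_nf

lemma exists_measureReal_compl_aliveBefore_le (hQ : Q.BoundedBy T K) (hT : H.evidence T ≠ 0)
    (ht : t ≤ T + 1) :
    ∃ B C : ℝ, 0 < B ∧ 0 < C ∧ ∀ (Ω : Type u) [MeasurableSpace Ω] (P : Measure Ω)
      [IsProbabilityMeasure P] (N : ℕ) [NeZero N] (S : ParticleSystem Q T N P),
        P.real (S.aliveBefore t)ᶜ ≤ B * Real.exp (-(C * N)) := by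
  induction t with
  | zero =>
    refine ⟨1, 1, one_pos, one_pos, fun Ω _ P _ N _ S => ?_⟩
    have huniv : S.aliveBefore 0 = Set.univ := Set.eq_univ_of_forall fun _ _ hs => by simp at hs
    rw [huniv, Set.compl_univ, measureReal_empty]
    positivity
  | succ t ih =>
    have ht' : t ≤ T := Nat.le_of_succ_le_succ ht
    obtain ⟨B, C, hB, hC, h⟩ := ih (t.le_succ.trans ht)
    obtain ⟨B', C', hB', hC', h'⟩ := exists_unnormEstConcentrates.{u} hQ hT ht'
    have hb := hQ.weightMean_pos hT ht'
    refine ⟨B + B', min C (C' * Q.weightMean t ^ 2), by positivity, by positivity,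
      fun Ω _ P _ N _ S => ?_⟩
    have hsub : (S.aliveBefore (t + 1))ᶜ ⊆
        (S.aliveBefore t)ᶜ ∪ (S.aliveBefore t \ S.aliveBefore (t + 1)) := fun ω hω => by
      by_cases hal : ω ∈ S.aliveBefore t
      · exact .inr ⟨hal, hω⟩
      · exact .inl hal
    calc P.real (S.aliveBefore (t + 1))ᶜ
        ≤ P.real (S.aliveBefore t)ᶜ + P.real (S.aliveBefore t \ S.aliveBefore (t + 1)) :=
          (measureReal_mono hsub).trans (measureReal_union_le _ _)
      _ ≤ B * Real.exp (-(C * N)) + B' * Real.exp (-(C' * Q.weightMean t ^ 2 * N)) :=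
          add_le_add (h Ω P N S) ((h' Ω P N S).measureReal_weight_eq_zero_le hQ hT ht')
      _ ≤ B * Real.exp (-(min C (C' * Q.weightMean t ^ 2) * N)) +
            B' * Real.exp (-(min C (C' * Q.weightMean t ^ 2) * N)) := by
          gcongr
          · exact min_le_left _ _
          · exact min_le_right _ _
      _ = _ := (add_mul _ _ _).symm

end ParticleSystem

lemma abs_sub_le_osc {Z : Type*} {h : Z → ℝ} (hb : ∃ c, ∀ x, |h x| ≤ c) (x x' : Z) :
    |h x - h x'| ≤ osc h := by
  obtain ⟨c, hc⟩ := hb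
  refine le_ciSup (f := fun p : Z × Z => |h p.1 - h p.2|) ⟨c + c, ?_⟩ (x, x')
  rintro _ ⟨p, rfl⟩
  exact (abs_sub _ _).trans (add_le_add (hc _) (hc _))

namespace ParticleSystem

variable {X Y : Type*} [MeasurableSpace X] [MeasurableSpace Y] {H : HMM X Y} {Q : Proposal H}
  {t T N : ℕ} {Ω : Type*} [MeasurableSpace Ω] {P : Measure Ω} {K : ℝ≥0}

lemma ae_ffbs_sub_integral_eq [IsFiniteMeasure P] (S : ParticleSystem Q T N P)
    [IsProbabilityMeasure (H.smooth T)] {h : (Fin (T + 1) → X) → ℝ}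
    (hh : Integrable h (H.smooth T)) (c : ℝ) :
    ∀ᵐ ω ∂P.restrict S.alive, S.ffbs h ω - ∫ z, h z ∂H.smooth T =
      H.est (S.cloud ω) T (fun z => h z - c) - ∫ z, (h z - c) ∂H.smooth T := by
  rw [alive_eq_aliveBefore]
  filter_upwards [S.ae_reachable_and_weight_pos le_rfl] with ω ⟨hd, hpos⟩
  have hest : H.est (S.cloud ω) T (fun z => h z - c) = H.est (S.cloud ω) T h - c := by
    have : (fun z => h z - c) = h - c • (1 : (Fin (T + 1) → X) → ℝ) := by
      ext z
      simp
    rw [this, map_sub, map_smul, HMM.est_one hd hpos, smul_eq_mul, mul_one]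
  rw [S.ffbs_eq_est, hest, integral_sub hh (integrable_const c), integral_const]
  simp

lemma EstConcentrates.ffbs [IsFiniteMeasure P] [IsProbabilityMeasure (H.smooth T)]
    {S : ParticleSystem Q T N P} {B C : ℝ} (hS : S.EstConcentrates T B C)
    {h : (Fin (T + 1) → X) → ℝ} (hm : Measurable h) (hb : ∃ c, ∀ z, |h z| ≤ c)
    (hosc : 0 < osc h) :
    HasSubgaussianTail (P.restrict S.alive) (fun ω => S.ffbs h ω - ∫ z, h z ∂H.smooth T) B
      (C * N / osc h ^ 2) := by
  obtain ⟨c, hc⟩ := hb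
  obtain ⟨z₀⟩ : Nonempty (Fin (T + 1) → X) := nonempty_of_isProbabilityMeasure (H.smooth T)
  have htail := hS (fun z => h z - h z₀) (hm.sub_const _) (osc h) hosc
    fun z => abs_sub_le_osc ⟨c, hc⟩ z z₀
  rw [← alive_eq_aliveBefore] at htail
  intro ε hε
  refine (measureReal_congr ?_).trans_le (htail ε hε)
  filter_upwards [S.ae_ffbs_sub_integral_eq
    (.of_bound hm.aestronglyMeasurable c (ae_of_all _ hc)) (h z₀)] with ω hω
  exact congrArg (fun y => ε ≤ |y|) hω

lemma measureReal_ffbs_eq_zero [IsFiniteMeasure P] [IsProbabilityMeasure (H.smooth T)]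
    (S : ParticleSystem Q T N P) {h : (Fin (T + 1) → X) → ℝ} (hb : ∃ c, ∀ z, |h z| ≤ c)
    (hosc : osc h = 0) {ε : ℝ} (hε : 0 < ε) :
    (P.restrict S.alive).real {ω | ε ≤ |S.ffbs h ω - ∫ z, h z ∂H.smooth T|} = 0 := by
  obtain ⟨z₀⟩ : Nonempty (Fin (T + 1) → X) := nonempty_of_isProbabilityMeasure (H.smooth T)
  obtain ⟨c, rfl⟩ : ∃ c, h = fun _ => c := ⟨h z₀, funext fun z => by
    simpa [hosc, sub_eq_zero] using abs_sub_le_osc hb z z₀⟩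
  refine (measureReal_eq_zero_iff (measure_ne_top _ _)).2 (measure_eq_zero_iff_ae_notMem.2 ?_)
  filter_upwards [S.ae_ffbs_sub_integral_eq (integrable_const c) c] with ω hω
  have hzero : H.est (S.cloud ω) T (fun _ => (0 : ℝ)) = 0 := map_zero _
  change ¬ ε ≤ |S.ffbs (fun _ => c) ω - ∫ _, c ∂H.smooth T|
  rw [hω]
  simpa [hzero] using hε

lemma exists_deviation_bound (hQ : Q.BoundedBy T K) (hT : H.evidence T ≠ 0) :
    ∃ B C : ℝ, 0 < B ∧ 0 < C ∧ ∀ (Ω : Type u) [MeasurableSpace Ω] (P : Measure Ω)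
      [IsProbabilityMeasure P] (N : ℕ) [NeZero N] (S : ParticleSystem Q T N P),
        P.real S.aliveᶜ ≤ B * Real.exp (-(C * N)) ∧
        ∀ ε > 0, ∀ h : (Fin (T + 1) → X) → ℝ, Measurable h → (∃ c, ∀ z, |h z| ≤ c) →
          P.real (S.alive ∩ {ω | ε ≤ |S.ffbs h ω - ∫ z, h z ∂H.smooth T|}) ≤
            B * Real.exp (-(C * N * ε ^ 2 / osc h ^ 2)) ∧
          (osc h = 0 →
            P.real (S.alive ∩ {ω | ε ≤ |S.ffbs h ω - ∫ z, h z ∂H.smooth T|}) = 0) := by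
  have := (hQ.regular hT).isProbabilityMeasure_smooth le_rfl
  have hb := hQ.weightMean_pos hT le_rfl
  obtain ⟨B₁, C₁, hB₁, hC₁, hext⟩ :=
    exists_measureReal_compl_aliveBefore_le.{u} hQ hT (le_refl (T + 1))
  obtain ⟨B₂, C₂, hB₂, hC₂, hconc⟩ := exists_unnormEstConcentrates.{u} hQ hT le_rfl
  set C₃ := C₂ * Q.weightMean T ^ 2 / 4
  have : 0 < C₃ := by positivity
  refine ⟨B₁ + 2 * B₂, min C₁ C₃, by positivity, by positivity, fun Ω _ P _ N _ S => ⟨?_, ?_⟩⟩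
  · rw [alive_eq_aliveBefore]
    refine (hext Ω P N S).trans ?_
    gcongr
    · linarith
    · exact min_le_left _ _
  intro ε hε h hm hbdd
  have halive : MeasurableSet S.alive :=
    S.alive_eq_aliveBefore ▸ S.measurableSet_aliveBefore (T + 1)
  rw [Set.inter_comm, ← measureReal_restrict_apply' halive]
  refine ⟨?_, fun hosc => S.measureReal_ffbs_eq_zero hbdd hosc hε⟩
  rcases eq_or_ne (osc h) 0 with hosc | hosc
  · rw [S.measureReal_ffbs_eq_zero hbdd hosc hε]
    positivity
  have hosc_pos : 0 < osc h := (Real.iSup_nonneg fun _ => abs_nonneg _).lt_of_ne' hosc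
  refine (((hconc Ω P N S).estConcentrates hQ hT le_rfl).ffbs hm hbdd hosc_pos ε hε).trans ?_
  rw [div_mul_eq_mul_div]
  gcongr
  · linarith
  · exact min_le_right _ _

lemma tendstoInMeasure_sum_weight_mul {Ω : Type u} [MeasurableSpace Ω] {P : Measure Ω}
    [IsProbabilityMeasure P] (hQ : Q.BoundedBy T K) (hT : H.evidence T ≠ 0) (ht : t ≤ T)
    (S : ∀ N, ParticleSystem Q T N P) {v : X → ℝ} (hv : Measurable v) {a : ℝ} (ha : 0 < a)
    (hva : ∀ x, |v x| ≤ a) :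
    TendstoInMeasure P
      (fun (N : ℕ) ω => (N : ℝ)⁻¹ * ∑ l, ((S N).weight t l ω : ℝ) * v ((S N).ξ t l ω))
      atTop (fun _ => Q.weightMean t * ∫ x, v x ∂H.filt t) := by
  obtain ⟨B₁, C₁, -, hC₁, hext⟩ :=
    exists_measureReal_compl_aliveBefore_le.{u} hQ hT (ht.trans T.le_succ)
  obtain ⟨B₂, C₂, -, hC₂, hconc⟩ := exists_unnormEstConcentrates.{u} hQ hT ht
  rw [tendstoInMeasure_iff_measureReal_norm]
  intro ε hε
  have hexp : ∀ b > 0, Tendsto (fun N : ℕ => Real.exp (-(b * N))) atTop (nhds 0) := fun b hb =>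
    Real.tendsto_exp_neg_atTop_nhds_zero.comp (tendsto_natCast_atTop_atTop.const_mul_atTop hb)
  have hlim : Tendsto (fun N : ℕ => B₁ * Real.exp (-(C₁ * N)) +
      B₂ * Real.exp (-(C₂ * ε ^ 2 / a ^ 2 * N))) atTop (nhds 0) := by
    simpa using ((hexp C₁ hC₁).const_mul B₁).add ((hexp _ (by positivity)).const_mul B₂)
  refine tendsto_of_tendsto_of_tendsto_of_le_of_le' tendsto_const_nhds hlim
    (.of_forall fun _ => measureReal_nonneg) ?_
  filter_upwards [eventually_ne_atTop 0] with N hN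
  have : NeZero N := ⟨hN⟩
  have htail : HasSubgaussianTail (P.restrict ((S N).aliveBefore t)) (fun ω =>
      (N : ℝ)⁻¹ * ∑ l, ((S N).weight t l ω : ℝ) * v ((S N).ξ t l ω) -
        Q.weightMean t * ∫ x, v x ∂H.filt t) B₂ (C₂ * N / a ^ 2 / 1 ^ 2) := by
    refine (hconc Ω P N (S N) (fun z => v (z (Fin.last t))) (hv.comp (measurable_pi_apply _)) a ha
      fun z => hva _).of_abs_le_mul one_pos ?_
    filter_upwards [(S N).ae_reachable ht] with ω hd
    rw [HMM.unnormEst_last hd, HMM.integral_filt hv, one_mul]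
    rfl
  calc _ ≤ _ := htail.measureReal_le_add ((S N).measurableSet_aliveBefore t) hε
    _ ≤ _ := add_le_add (hext Ω P N (S N)) (le_of_eq (by ring_nf))

end ParticleSystem

namespace Proposal

variable {X Y : Type*} [MeasurableSpace X] [MeasurableSpace Y] {H : HMM X Y} {Q : Proposal H}
  {t T : ℕ} {K : ℝ≥0}

lemma exists_boundedBy (hϑ : ∃ K : ℝ≥0, ∀ t, 1 ≤ t → t ≤ T → ∀ x, Q.ϑ t x ≤ K)
    (hw₀ : ∃ K : ℝ≥0, ∀ᵐ x ∂Q.ρ₀, Q.w₀ x ≤ K)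
    (hw : ∃ K : ℝ≥0, ∀ t, 1 ≤ t → t ≤ T → ∀ x x', Q.w t x x' ≤ K) :
    ∃ K, Q.BoundedBy T K := by
  obtain ⟨K₁, h₁⟩ := hϑ
  obtain ⟨K₂, h₂⟩ := hw₀
  obtain ⟨K₃, h₃⟩ := hw
  refine ⟨K₁ + K₂ + K₃ + 1, by positivity, fun t ht x => ?_, ?_, fun t ht x x' => ?_⟩
  · exact (h₁ _ t.succ_pos ht x).trans (by rw [add_assoc, add_assoc]; exact le_self_add)
  · filter_upwards [h₂] with x hx
    exact hx.trans (by rw [add_assoc, add_right_comm]; exact le_add_self)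
  · exact (h₃ _ t.succ_pos ht x x').trans (by rw [add_right_comm]; exact le_add_self)

lemma BoundedBy.weightMean_mul_integral_F_one (hQ : Q.BoundedBy T K) (hT : H.evidence T ≠ 0)
    (ht : t < T) :
    Q.weightMean (t + 1) * ∫ x, (H.F (t + 1) T x fun _ => 1).toReal ∂H.filt (t + 1) =
      (∫ x, (H.F t T x fun _ => 1).toReal ∂H.filt t) / ∫ x, (Q.ϑ (t + 1) x : ℝ) ∂H.filt t := by
  have h := hQ.regular hT
  have hsucc : t + 1 ≤ T := ht
  rw [h.integral_toReal_F_one hsucc, h.integral_toReal_F_one ht.le, weightMean, div_mul_eq_mul_div,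
    ← ENNReal.toReal_mul, mul_comm (_ / _),
    ← mul_div_assoc, ENNReal.div_mul_cancel (h.evidence_ne_zero hsucc) (h.evidence_ne_top hsucc)]

end Proposal

theorem mainTheorem1_general {X Y : Type*} [MeasurableSpace X] [MeasurableSpace Y]
    (H : HMM X Y) (Q : Proposal H) (T : ℕ)
    (hT : H.evidence T ≠ 0)
    (hϑ_bdd : ∃ K : ℝ≥0, ∀ t, 1 ≤ t → t ≤ T → ∀ x, Q.ϑ t x ≤ K)
    (hw₀_bdd : ∃ K : ℝ≥0, ∀ᵐ x ∂Q.ρ₀, Q.w₀ x ≤ K)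
    (hw_bdd : ∃ K : ℝ≥0, ∀ t, 1 ≤ t → t ≤ T → ∀ x x', Q.w t x x' ≤ K) :
    (∃ B C : ℝ, 0 < B ∧ 0 < C ∧
      ∀ (Ω : Type*) [MeasurableSpace Ω] (P : Measure Ω) [IsProbabilityMeasure P]
        (N : ℕ), 1 ≤ N → ∀ S : ParticleSystem Q T N P,
        P.real S.aliveᶜ ≤ B * Real.exp (-(C * N)) ∧
        ∀ (ε : ℝ), 0 < ε → ∀ (h : (Fin (T + 1) → X) → ℝ), Measurable h →
          (∃ c, ∀ x, |h x| ≤ c) →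
          P.real (S.alive ∩ {ω | ε ≤ |S.ffbs h ω - ∫ x, h x ∂(H.smooth T)|})
              ≤ B * Real.exp (-(C * N * ε ^ 2 / osc h ^ 2)) ∧
          (osc h = 0 →
            P.real (S.alive ∩ {ω | ε ≤ |S.ffbs h ω - ∫ x, h x ∂(H.smooth T)|}) = 0)) ∧
    (∀ (Ω : Type*) [MeasurableSpace Ω] (P : Measure Ω) [IsProbabilityMeasure P]
      (S : ∀ N : ℕ, ParticleSystem Q T N P), ∀ t < T,
      TendstoInMeasure P
        (fun (N : ℕ) ω => (N : ℝ)⁻¹ * ∑ l : Fin N,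
          ((S N).weight (t + 1) l ω : ℝ) *
            (H.F (t + 1) T ((S N).ξ (t + 1) l ω) (fun _ => 1)).toReal)
        atTop
        (fun _ => (∫ x, (H.F t T x (fun _ => 1)).toReal ∂(H.filt t)) /
          ∫ x, (Q.ϑ (t + 1) x : ℝ) ∂(H.filt t))) := by
  obtain ⟨K, hQ⟩ := Proposal.exists_boundedBy hϑ_bdd hw₀_bdd hw_bdd
  constructor
  · obtain ⟨B, C, hB, hC, hdev⟩ := ParticleSystem.exists_deviation_bound hQ hT
    refine ⟨B, C, hB, hC, fun Ω _ P _ N hN => ?_⟩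
    have : NeZero N := ⟨Nat.one_le_iff_ne_zero.1 hN⟩
    exact hdev Ω P N
  · intro Ω _ P _ S t ht
    rw [← hQ.weightMean_mul_integral_F_one hT ht]
    have hsucc : t + 1 ≤ T := ht
    have hpos : 0 < ((K ^ 2) ^ (T - (t + 1)) : ℝ≥0) := pow_pos (pow_pos hQ.pos 2) _
    exact ParticleSystem.tendstoInMeasure_sum_weight_mul hQ hT hsucc S
      (v := fun x => (H.F (t + 1) T x fun _ => 1).toReal) (HMM.measurable_F_one _ _).ennreal_toReal
      (NNReal.coe_pos.2 hpos) ((hQ.regular hT).abs_toReal_F_one_le hsucc)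

theorem mainTheorem1 {X Y : Type*}
    [TopologicalSpace X] [PolishSpace X] [MeasurableSpace X] [BorelSpace X]
    [TopologicalSpace Y] [PolishSpace Y] [MeasurableSpace Y] [BorelSpace Y]
    (H : HMM X Y) (Q : Proposal H) (T : ℕ)
    -- positive and bounded likelihoods
    (hg_pos : ∀ t ≤ T, ∀ x, 0 < H.g t x)
    (hg_bdd : ∃ K : ℝ≥0, ∀ t ≤ T, ∀ x, H.g t x ≤ K)
    -- bounded adjustment weights and importance weights
    (hϑ_bdd : ∃ K : ℝ≥0, ∀ t, 1 ≤ t → t ≤ T → ∀ x, Q.ϑ t x ≤ K)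
    (hw₀_bdd : ∃ K : ℝ≥0, ∀ᵐ x ∂Q.ρ₀, Q.w₀ x ≤ K)
    (hw_bdd : ∃ K : ℝ≥0, ∀ t, 1 ≤ t → t ≤ T → ∀ x x', Q.w t x x' ≤ K) :
    -- the exponential deviation inequality, with constants that do not depend on
    -- the number of particles, the level, the function or the run of the algorithm
    (∃ B C : ℝ, 0 < B ∧ 0 < C ∧
      ∀ (Ω : Type*) [MeasurableSpace Ω] (P : Measure Ω) [IsProbabilityMeasure P]
        (N : ℕ), 1 ≤ N → ∀ S : ParticleSystem Q T N P,
        -- the estimator is undefined with exponentially small probability only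
        P.real S.aliveᶜ ≤ B * Real.exp (-(C * N)) ∧
        ∀ (ε : ℝ), 0 < ε → ∀ (h : (Fin (T + 1) → X) → ℝ), Measurable h →
          (∃ c, ∀ x, |h x| ≤ c) →
          P.real (S.alive ∩ {ω | ε ≤ |S.ffbs h ω - ∫ x, h x ∂(H.smooth T)|})
              ≤ B * Real.exp (-(C * N * ε ^ 2 / osc h ^ 2)) ∧
          -- for `osc h = 0` the right-hand side is to be read as `B * exp (-∞) = 0`
          (osc h = 0 →
            P.real (S.alive ∩ {ω | ε ≤ |S.ffbs h ω - ∫ x, h x ∂(H.smooth T)|}) = 0)) ∧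
    -- the law of large numbers for the weighted sums, at the times `t + 1 = 1, …, T`
    (∀ (Ω : Type*) [MeasurableSpace Ω] (P : Measure Ω) [IsProbabilityMeasure P]
      (S : ∀ N : ℕ, ParticleSystem Q T N P), ∀ t < T,
      TendstoInMeasure P
        (fun (N : ℕ) ω => (N : ℝ)⁻¹ * ∑ l : Fin N,
          ((S N).weight (t + 1) l ω : ℝ) *
            (H.F (t + 1) T ((S N).ξ (t + 1) l ω) (fun _ => 1)).toReal)
        atTop
        (fun _ => (∫ x, (H.F t T x (fun _ => 1)).toReal ∂(H.filt t)) /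
          ∫ x, (Q.ϑ (t + 1) x : ℝ) ∂(H.filt t))) :=
  mainTheorem1_general H Q T (HMM.evidence_ne_zero hg_pos) hϑ_bdd hw₀_bdd hw_bdd
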